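/- **Setting.** Let $\pi$ be a probability distribution on $\mathbb{R}^d\times[k]$, the law of $(X,Y)$. Let $g:\mathbb{R}^d\to\Delta^{k-1}$ (predictor), $c:\Delta^{k-1}\to[k]$ (classification function) and $h:\Delta^{k-1}\to[0,1]$ (confidence function) be measurable, and write $c(X)=c(g(X))$, $h(X)=h(g(X))$. Let $\varphi:[0,1]\to\mathbb{R}$ be continuous and convex on $[0,1]$ and $C^1$ on $(0,1)$ ($\varphi'$ may be unbounded at the endpoints, as for $x\log x+(1-x)\log(1-x)$), and let $d_\varphi(x,y)=\varphi(x)-\varphi(y)-\varphi'(y)(x-y)$ be its Bregman divergence. **Estimator.** Let $(x_1,y_1),(x_2,y_2),\dots$ be i.i.d. with law $\pi$. For a kernel $K:\mathbb{R}\to\mathbb{R}$ and bandwidth $\sigma>0$ put $K_\sigma(u)=\frac1\sigma K(u/\sigma)$, let $$\hat m_{\sigma}(t)=\frac{\sum_{i=1}^n K_\sigma(t-h(x_i))\,\mathbb{1}_{y_i=c(x_i)}}{\sum_{i=1}^n K_\sigma(t-h(x_i))}$$ be the Nadaraya–Watson estimate of $\mathbb{E}[\mathbb{1}_{Y=c(X)}\mid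 h(X)=t]$ from the first $n$ data points, and, for bandwidths $\sigma_n>0$, let $$\hat d_{\varphi,n}=\frac1n\sum_{i=1}^n\Big(\varphi\big(\hat m_{\sigma_n}(h(x_i))\big)-\varphi\big(h(x_i)\big)-\varphi'\big(h(x_i)\big)\big(\mathbb{1}_{y_i=c(x_i)}-h(x_i)\big)\Big).$$ **Assumptions.** 1. There is $K^*<\infty$ with $0\le K\le K^*$, and $K(u)=L(|u|)$ for a nonincreasing $L$ on $[0,\infty)$ with $\lim_{u\to\infty}uL(u)=0$ and $L(u^*)>0$ for some $u^*>0$. 2. $\sigma_n\to0$ and $n\sigma_n^2/\log n\to\infty$. 3. $h(X)$ has a Lebesgue density $p_{h(X)}$ and there is $\delta>0$ with $p_{h(X)}(h(X))\ge\delta$ almost surely (this holds in particular if the density is at least $\delta$ on the support of $h(X)$). 4. A version of $t\mapsto\mathbb{E}[\mathbb{1}_{Y=c(X)}\mid h(X)=t]$ is continuous on the support of $h(X)$. **Conclusion.** The variable $d_\varphi\big(\mathbb{E}[\mathbb{1}_{Y=c(X)}\mid h(X)],h(X)\big)$ is measurable up to a null set and almost surely nonnegative, so it has an expectation in $[0,\infty]$,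 and $$\hat d_{\varphi,n}\to\mathbb{E}\Big[d_\varphi\big(\mathbb{E}[\mathbb{1}_{Y=c(X)}\mid h(X)],h(X)\big)\Big]\quad\text{in probability as }n\to\infty,$$ where, if the expectation is infinite, this means $\mathbb{P}(\hat d_{\varphi,n}\le M)\to0$ for every $M\in\mathbb{R}$. If $\varphi$ is $C^1$ on the closed interval $[0,1]$, the expectation is finite. -/

import Mathlib

open MeasureTheory ProbabilityTheory Filter Topology Set
open scoped ENNReal

noncomputable section

/-- One-dimensional kernel assumptions: `K` takes values in `[0, Kmax]`, `K x = L |x|` with `L`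
nonincreasing on `[0, ∞)`, `u * L u → 0` as `u → ∞`, and `L u > 0` for some `u > 0`. -/
def IsRegularKernel (K : ℝ → ℝ) : Prop :=
  (∃ Kmax : ℝ, ∀ x, K x ∈ Icc 0 Kmax) ∧
    ∃ L : ℝ → ℝ, AntitoneOn L (Ici 0) ∧ (∀ x, K x = L |x|) ∧
      Tendsto (fun u : ℝ => u * L u) atTop (𝓝 0) ∧ ∃ u : ℝ, 0 < u ∧ 0 < L u

/-- The rescaled kernel `K_σ(x) = (1/σ) K(x/σ)`. -/
def scaledKernel (K : ℝ → ℝ) (σ x : ℝ) : ℝ := (1 / σ) * K (x / σ)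

/-- The Nadaraya–Watson kernel regression estimate at `t` from the data `(x i, y i)`, `i < n`. -/
def nadarayaWatson (K : ℝ → ℝ) (σ : ℝ) {n : ℕ} (x y : Fin n → ℝ) (t : ℝ) : ℝ :=
  (∑ i, scaledKernel K σ (t - x i) * y i) / ∑ i, scaledKernel K σ (t - x i)

/-- The derivative of `φ` as a function on `[0, 1]` (one-sided at the endpoints). -/
def derivUnit (φ : ℝ → ℝ) (y : ℝ) : ℝ := derivWithin φ (Icc 0 1) y

/-- The Bregman divergence of a function `φ` on `[0, 1]`. -/
def bregman (φ : ℝ → ℝ) (x y : ℝ) : ℝ := φ x - φ y - derivUnit φ y * (x - y)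

/-- The convex generators considered on `[0, 1]`: finite, continuous and convex on
`[0, 1]`, and `C¹` on `(0, 1)`; the derivative may blow up at the endpoints, as it does for
`x log x + (1 - x) log (1 - x)`. -/
structure IsBregmanGenerator (φ : ℝ → ℝ) : Prop where
  continuousOn : ContinuousOn φ (Icc 0 1)
  convexOn : ConvexOn ℝ (Icc 0 1) φ
  contDiffOn : ContDiffOn ℝ 1 φ (Ioo 0 1)

section Classification

variable {d k : ℕ}

/-- The confidence `h(X) = h(g(X))` of a data/label pair. -/
def confidence (g : EuclideanSpace ℝ (Fin d) → stdSimplex ℝ (Fin k))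
    (h : stdSimplex ℝ (Fin k) → Icc (0 : ℝ) 1) (z : EuclideanSpace ℝ (Fin d) × Fin k) : ℝ :=
  h (g z.1)

/-- The accuracy indicator `1_{Y = c(X)}`, where `c(X) = c(g(X))`, of a data/label pair. -/
def accuracy (g : EuclideanSpace ℝ (Fin d) → stdSimplex ℝ (Fin k))
    (c : stdSimplex ℝ (Fin k) → Fin k) (z : EuclideanSpace ℝ (Fin d) × Fin k) : ℝ :=
  if z.2 = c (g z.1) then 1 else 0

/-- The conditional expectation `E[1_{Y = c(X)} | h(X)]` under the joint law `π` of `(X, Y)`. -/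
def condAccuracy (π : Measure (EuclideanSpace ℝ (Fin d) × Fin k))
    (g : EuclideanSpace ℝ (Fin d) → stdSimplex ℝ (Fin k))
    (c : stdSimplex ℝ (Fin k) → Fin k) (h : stdSimplex ℝ (Fin k) → Icc (0 : ℝ) 1) :
    EuclideanSpace ℝ (Fin d) × Fin k → ℝ :=
  π[accuracy g c | MeasurableSpace.comap (confidence g h) inferInstance]

/-- The pointwise calibration divergence `d_φ(E[1_{Y = c(X)} | h(X)], h(X))`. -/
def calibrationDivergence (π : Measure (EuclideanSpace ℝ (Fin d) × Fin k))
    (g : EuclideanSpace ℝ (Fin d) → stdSimplex ℝ (Fin k))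
    (c : stdSimplex ℝ (Fin k) → Fin k) (h : stdSimplex ℝ (Fin k) → Icc (0 : ℝ) 1)
    (φ : ℝ → ℝ) (z : EuclideanSpace ℝ (Fin d) × Fin k) : ℝ :=
  bregman φ (condAccuracy π g c h z) (confidence g h z)

/-- The plug-in estimate of the confidence calibration error from data `z i = (x i, y i)`, `i < n`:
`(1/n) ∑ᵢ (φ(m̂_σ(h(xᵢ))) - φ(h(xᵢ)) - φ'(h(xᵢ)) (1_{yᵢ = c(xᵢ)} - h(xᵢ)))`, where `m̂_σ` is the
Nadaraya–Watson estimate of `1_{Y = c(X)}` given `h(X)` from the same data. -/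
def pluginEstimate (K : ℝ → ℝ) (σ : ℝ) (g : EuclideanSpace ℝ (Fin d) → stdSimplex ℝ (Fin k))
    (c : stdSimplex ℝ (Fin k) → Fin k) (h : stdSimplex ℝ (Fin k) → Icc (0 : ℝ) 1)
    (φ : ℝ → ℝ) {n : ℕ} (z : Fin n → EuclideanSpace ℝ (Fin d) × Fin k) : ℝ :=
  (1 / (n : ℝ)) * ∑ i,
    (φ (nadarayaWatson K σ (fun j => confidence g h (z j)) (fun j => accuracy g c (z j))
        (confidence g h (z i)))
      - φ (confidence g h (z i))
      - derivUnit φ (confidence g h (z i)) * (accuracy g c (z i) - confidence g h (z i)))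

end Classification

end

/-!
The plug-in estimate is consistent because it splits into an average of i.i.d. variables and an
error that vanishes in mean.

Write `T = h(X)`, `A = 1_{Y = c(X)}`, and let `m` be the continuous version of `E[A | T = ·]`. Up to
the error made by replacing `φ(m̂(Tᵢ))` with `φ(m(Tᵢ))`, the estimate is the average of independent
copies of `W = φ(m(T)) - φ(T) - φ'(T) (A - T)`.

*The average.* As `φ'` may blow up at `0` and `1`, integrability of `W` is not automatic. By
convexity `W` differs from the nonnegative variable `d_φ(A, T)` by a bounded one, and `d_φ(A, T)` is
the mixture `A d_φ(1, T) + (1 - A) d_φ(0, T)`. Conditioning on `T`, which for nonnegative variables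
requires no integrability (`lintegral_mul_ofReal_condExp`), turns it into
`m(T) d_φ(1, T) + (1 - m(T)) d_φ(0, T)`, which differs from `d_φ(m(T), T)` by a bounded variable.
Hence `W` and the calibration divergence are integrable together, with the same mean
(`IsBregmanGenerator.integrable_summand_iff`). The strong law of large numbers settles the
integrable case. Otherwise `W` is bounded below with infinite mean, and the strong law for its
truncations shows that the averages tend to `∞` (`tendsto_measure_average_le`).

*The error.* No uniform control of the kernel estimate is needed. The summands
`|φ(m̂(Tᵢ)) - φ(m(Tᵢ))|` are bounded and identically distributed, so it suffices that `m̂` converges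
to `m` in probability at one random design point, independent of the remaining sample, and by
dominated convergence at almost every fixed design point (`tendsto_lintegral_pluginError`). Almost
every value `t` of `T` has positive density, so by Lebesgue differentiation the ball of radius `r`
around `t` has mass at least `c r` for small `r`. Therefore the kernel of bandwidth `s` has mass
`E[K((t - T) / s)]` of order at least `s`. Its part at a fixed distance from `t` is `o(s)` since
`u K(u) → 0`, so continuity of `m` at `t` makes the bias negligible, and Chebyshev's inequality
controls the fluctuations once `n s → ∞`
(`tendsto_measureReal_le_abs_centeredRegression_sub`).
-/

/-! ### Bregman generators -/

namespace IsBregmanGenerator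

variable {φ : ℝ → ℝ}

theorem differentiableAt (hφ : IsBregmanGenerator φ) {t : ℝ} (ht : t ∈ Ioo (0 : ℝ) 1) :
    DifferentiableAt ℝ φ t :=
  (hφ.contDiffOn.differentiableOn one_ne_zero).differentiableAt (Ioo_mem_nhds ht.1 ht.2)

theorem derivUnit_eq_deriv {t : ℝ} (ht : t ∈ Ioo (0 : ℝ) 1) :
    derivUnit φ t = deriv φ t :=
  derivWithin_of_mem_nhds (Icc_mem_nhds ht.1 ht.2)

/-- A convex function lies above its tangent lines. -/
theorem bregman_nonneg (hφ : IsBregmanGenerator φ) {x t : ℝ} (hx : x ∈ Icc (0 : ℝ) 1)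
    (ht : t ∈ Ioo (0 : ℝ) 1) : 0 ≤ bregman φ x t := by
  have htI : t ∈ Icc (0 : ℝ) 1 := Ioo_subset_Icc_self ht
  have hd := hφ.differentiableAt ht
  unfold bregman
  rw [derivUnit_eq_deriv ht]
  rcases lt_trichotomy t x with h | h | h
  · have := hφ.convexOn.deriv_le_slope htI hx h hd
    rw [slope_def_field, le_div_iff₀ (by linarith)] at this
    linarith
  · subst h; simp
  · have := hφ.convexOn.slope_le_deriv hx htI h hd
    rw [slope_def_field, div_le_iff₀ (by linarith)] at this
    linarith

/-- A Bregman generator has a continuous extension from `[0, 1]` to the whole line. -/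
theorem exists_continuous_eqOn (hφ : IsBregmanGenerator φ) :
    ∃ f : ℝ → ℝ, Continuous f ∧ EqOn f φ (Icc 0 1) :=
  ⟨IccExtend zero_le_one ((Icc (0 : ℝ) 1).domRestrict φ),
    (continuousOn_iff_continuous_domRestrict.mp hφ.continuousOn).Icc_extend',
    fun _ ht => IccExtend_of_mem zero_le_one _ ht⟩

theorem exists_abs_le (hφ : IsBregmanGenerator φ) :
    ∃ C : ℝ, 0 ≤ C ∧ ∀ t ∈ Icc (0 : ℝ) 1, |φ t| ≤ C := by
  obtain ⟨C, hC⟩ := isCompact_Icc.exists_bound_of_continuousOn hφ.continuousOn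
  exact ⟨C, (norm_nonneg _).trans (hC 0 (by simp)), hC⟩

end IsBregmanGenerator

/-! ### Conditional expectations -/

/-- Pull-out property for conditional expectations of nonnegative variables, without any
integrability requirement on the factor `f`. -/
theorem lintegral_mul_ofReal_condExp {Ω : Type*} {m m0 : MeasurableSpace Ω} {μ : Measure Ω}
    [IsFiniteMeasure μ] (hm : m ≤ m0) {Y : Ω → ℝ} (hY : Integrable Y μ) (hY0 : 0 ≤ᵐ[μ] Y)
    {f : Ω → ℝ≥0∞} (hf : Measurable[m] f) :
    ∫⁻ x, f x * ENNReal.ofReal (Y x) ∂μ = ∫⁻ x, f x * ENNReal.ofReal (μ[Y|m] x) ∂μ := by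
  have h1 : ∀ g : Ω → ℝ≥0∞, AEMeasurable g μ →
      ∫⁻ x, f x * g x ∂μ = ∫⁻ x, f x ∂((μ.withDensity g).trim hm) := by
    intro g hg
    rw [lintegral_trim hm hf, lintegral_withDensity_eq_lintegral_mul₀ hg
      (hf.mono hm le_rfl).aemeasurable]
    simp only [Pi.mul_apply, mul_comm]
  rw [h1 _ hY.aemeasurable.ennreal_ofReal, h1 _ integrable_condExp.aemeasurable.ennreal_ofReal]
  congr 1
  refine @Measure.ext _ m _ _ fun s hs => ?_
  rw [trim_measurableSet_eq hm hs, trim_measurableSet_eq hm hs, withDensity_apply _ (hm s hs),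
    withDensity_apply _ (hm s hs), ← setLIntegral_condLExp hm μ _ hs]
  exact lintegral_congr_ae (ae_restrict_of_ae (condLExp_ofReal m hY hY0))

/-! ### Regular kernels -/

namespace IsRegularKernel

variable {K : ℝ → ℝ}

theorem nonneg (hK : IsRegularKernel K) (x : ℝ) : 0 ≤ K x := by
  obtain ⟨⟨M, hM⟩, -⟩ := hK
  exact (hM x).1

theorem anti (hK : IsRegularKernel K) {x y : ℝ} (h : |x| ≤ |y|) : K y ≤ K x := by
  obtain ⟨-, L, hL, hKL, -⟩ := hK
  rw [hKL, hKL]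
  exact hL (mem_Ici.2 (abs_nonneg _)) (mem_Ici.2 (abs_nonneg _)) h

theorem le_zero (hK : IsRegularKernel K) (x : ℝ) : K x ≤ K 0 := hK.anti (by simp)

theorem exists_pos (hK : IsRegularKernel K) : ∃ u : ℝ, 0 < u ∧ 0 < K u := by
  obtain ⟨-, L, hL, hKL, -, u, hu, hLu⟩ := hK
  exact ⟨u, hu, by rwa [hKL, abs_of_pos hu]⟩

theorem zero_pos (hK : IsRegularKernel K) : 0 < K 0 := by
  obtain ⟨u, -, hu⟩ := hK.exists_pos
  exact hu.trans_le (hK.le_zero u)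

theorem tendsto_mul (hK : IsRegularKernel K) : Tendsto (fun u => u * K u) atTop (𝓝 0) := by
  obtain ⟨-, L, hL, hKL, h, -⟩ := hK
  refine h.congr' ?_
  filter_upwards [eventually_ge_atTop 0] with u hu
  rw [hKL, abs_of_nonneg hu]

theorem measurable (hK : IsRegularKernel K) : Measurable K := by
  obtain ⟨-, L, hL, hKL, -⟩ := hK
  have h : Antitone fun u : ℝ => L (max u 0) := fun a b hab =>
    hL (mem_Ici.2 (le_max_right _ _)) (mem_Ici.2 (le_max_right _ _)) (max_le_max_right _ hab)
  have h2 : K = (fun u : ℝ => L (max u 0)) ∘ fun x => |x| := by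
    ext x
    simp [hKL]
  rw [h2]
  exact h.measurable.comp measurable_abs

end IsRegularKernel

/-! ### Regression models -/

/-- `m` is a regression function of the response `A`, with values in `[0, 1]`, on the real
covariate `T`: it takes values in `[0, 1]` and `m ∘ T` is a version of `E[A | T]`. -/
structure IsRegressionModel {α : Type*} [MeasurableSpace α] (π : Measure α) (T A : α → ℝ)
    (m : ℝ → ℝ) : Prop where
  measurable_covariate : Measurable T
  measurable_response : Measurable A
  response_mem : ∀ z, A z ∈ Icc (0 : ℝ) 1
  measurable_regression : Measurable m
  regression_mem : ∀ t, m t ∈ Icc (0 : ℝ) 1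
  condExp_eq : π[A | MeasurableSpace.comap T inferInstance] =ᵐ[π] fun z => m (T z)

namespace IsRegressionModel

variable {α : Type*} [MeasurableSpace α] {π : Measure α} {T A : α → ℝ} {m : ℝ → ℝ}

theorem abs_response_sub_le (H : IsRegressionModel π T A m) (z : α) (t : ℝ) :
    |A z - m t| ≤ 1 := by
  have h1 := H.response_mem z
  have h2 := H.regression_mem t
  rw [abs_le]
  constructor <;> linarith [h1.1, h1.2, h2.1, h2.2]

theorem abs_regression_sub_le (H : IsRegressionModel π T A m) (s t : ℝ) :
    |m s - m t| ≤ 1 := by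
  have h1 := H.regression_mem s
  have h2 := H.regression_mem t
  rw [abs_le]
  constructor <;> linarith [h1.1, h1.2, h2.1, h2.2]

variable [IsProbabilityMeasure π]

theorem integrable_response (H : IsRegressionModel π T A m) : Integrable A π :=
  Integrable.of_bound H.measurable_response.aestronglyMeasurable 1
    (ae_of_all _ fun z => by
      rw [Real.norm_eq_abs, abs_of_nonneg (H.response_mem z).1]; exact (H.response_mem z).2)

theorem integral_mul_eq (H : IsRegressionModel π T A m) {f : ℝ → ℝ} (hf : Measurable f) {C : ℝ}
    (hC : ∀ t, |f t| ≤ C) : ∫ z, f (T z) * A z ∂π = ∫ z, f (T z) * m (T z) ∂π := by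
  have hm : MeasurableSpace.comap T inferInstance ≤ _ := H.measurable_covariate.comap_le
  rw [← integral_condExp hm]
  refine integral_congr_ae ?_
  have hfT : StronglyMeasurable[MeasurableSpace.comap T inferInstance] fun z => f (T z) :=
    (hf.comp (comap_measurable T)).stronglyMeasurable
  have h1 := condExp_stronglyMeasurable_mul_of_bound hm hfT H.integrable_response C
    (ae_of_all _ fun z => hC (T z))
  filter_upwards [h1, H.condExp_eq] with z hz1 hz2
  have hz1' : (π[fun z => f (T z) * A z | MeasurableSpace.comap T inferInstance]) z =
    f (T z) * (π[A | MeasurableSpace.comap T inferInstance]) z := hz1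
  rw [hz1', hz2]

theorem lintegral_mul_eq (H : IsRegressionModel π T A m) {f : ℝ → ℝ≥0∞} (hf : Measurable f) :
    ∫⁻ z, f (T z) * ENNReal.ofReal (A z) ∂π = ∫⁻ z, f (T z) * ENNReal.ofReal (m (T z)) ∂π := by
  have hm : MeasurableSpace.comap T inferInstance ≤ _ := H.measurable_covariate.comap_le
  refine (lintegral_mul_ofReal_condExp hm H.integrable_response
    (ae_of_all _ fun z => (H.response_mem z).1) (hf.comp (comap_measurable T))).trans ?_
  refine lintegral_congr_ae ?_
  filter_upwards [H.condExp_eq] with z hz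
  rw [hz]; rfl

/-- The complementary response `1 - A` has regression function `1 - m`. -/
theorem one_sub (H : IsRegressionModel π T A m) :
    IsRegressionModel π T (fun z => 1 - A z) fun t => 1 - m t where
  measurable_covariate := H.measurable_covariate
  measurable_response := H.measurable_response.const_sub 1
  response_mem z := ⟨sub_nonneg.2 (H.response_mem z).2, by linarith [(H.response_mem z).1]⟩
  measurable_regression := H.measurable_regression.const_sub 1
  regression_mem t := ⟨sub_nonneg.2 (H.regression_mem t).2, by linarith [(H.regression_mem t).1]⟩
  condExp_eq := by
    have hm : MeasurableSpace.comap T inferInstance ≤ _ := H.measurable_covariate.comap_le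
    have h := condExp_sub (μ := π) (integrable_const (1 : ℝ)) H.integrable_response
      (MeasurableSpace.comap T inferInstance)
    rw [condExp_const hm] at h
    filter_upwards [h, H.condExp_eq] with z h1 h2
    have h1' : (π[fun z => 1 - A z | MeasurableSpace.comap T inferInstance]) z =
      1 - (π[A | MeasurableSpace.comap T inferInstance]) z := h1
    rw [h1', h2]

end IsRegressionModel

/-! ### Kernel averages at a point -/

section KernelAverage

variable {α : Type*} [MeasurableSpace α] {π : Measure α} [IsProbabilityMeasure π] {T A : α → ℝ}
  {m : ℝ → ℝ} {K : ℝ → ℝ} {t : ℝ}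

theorem IsRegularKernel.integrable_comp (hK : IsRegularKernel K) (hT : Measurable T) (t s : ℝ) :
    Integrable (fun z => K ((t - T z) / s)) π :=
  Integrable.of_bound (hK.measurable.comp ((hT.const_sub t).div_const s)).aestronglyMeasurable
    (K 0) (ae_of_all _ fun z => by
      rw [Real.norm_eq_abs, abs_of_nonneg (hK.nonneg _)]; exact hK.le_zero _)

/-- If small balls around `t` have mass at least proportional to their radius, then so does the
average of the kernel of bandwidth `s`. -/
theorem IsRegularKernel.exists_mul_le_integral (hK : IsRegularKernel K) (hT : Measurable T)
    (hball : ∃ c > 0, ∀ᶠ r in 𝓝[>] (0 : ℝ), c * r ≤ π.real (T ⁻¹' Metric.closedBall t r)) :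
    ∃ c > 0, ∀ᶠ s in 𝓝[>] (0 : ℝ), c * s ≤ ∫ z, K ((t - T z) / s) ∂π := by
  obtain ⟨c, hc, hball⟩ := hball
  obtain ⟨u, hu, hKu⟩ := hK.exists_pos
  have hlim : Tendsto (fun s : ℝ => u * s) (𝓝[>] 0) (𝓝[>] 0) := by
    refine tendsto_nhdsWithin_iff.2 ⟨?_, ?_⟩
    · have : Tendsto (fun s : ℝ => u * s) (𝓝 0) (𝓝 (u * 0)) := tendsto_id.const_mul u
      rw [mul_zero] at this
      exact this.mono_left nhdsWithin_le_nhds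
    · filter_upwards [self_mem_nhdsWithin] with s hs using mul_pos hu hs
  refine ⟨K u * (c * u), by positivity, ?_⟩
  filter_upwards [hlim.eventually hball, self_mem_nhdsWithin] with s hs (hs0 : 0 < s)
  have hset : MeasurableSet (T ⁻¹' Metric.closedBall t (u * s)) :=
    hT Metric.isClosed_closedBall.measurableSet
  calc K u * (c * u) * s = K u * (c * (u * s)) := by ring
    _ ≤ K u * π.real (T ⁻¹' Metric.closedBall t (u * s)) := by gcongr
    _ = ∫ z, (T ⁻¹' Metric.closedBall t (u * s)).indicator (fun _ => K u) z ∂π := by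
        rw [integral_indicator_const _ hset, smul_eq_mul, mul_comm]
    _ ≤ ∫ z, K ((t - T z) / s) ∂π := by
        refine integral_mono ((integrable_const _).indicator hset) (hK.integrable_comp hT t s)
          fun z => ?_
        by_cases hz : z ∈ T ⁻¹' Metric.closedBall t (u * s)
        · rw [indicator_of_mem hz]
          refine hK.anti ?_
          rw [mem_preimage, Metric.mem_closedBall, dist_comm, Real.dist_eq] at hz
          rw [abs_div, abs_of_pos hs0, abs_of_pos hu, div_le_iff₀ hs0]
          exact hz
        · rw [indicator_of_notMem hz]
          exact hK.nonneg _

/-- The localized bias of kernel regression at a continuity point is negligible: outside a fixed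
neighbourhood of `t` the kernel is `o(s)`, while its total mass is at least of order `s`. -/
theorem IsRegularKernel.eventually_integral_mul_abs_sub_le (hK : IsRegularKernel K)
    (H : IsRegressionModel π T A m)
    (hball : ∃ c > 0, ∀ᶠ r in 𝓝[>] (0 : ℝ), c * r ≤ π.real (T ⁻¹' Metric.closedBall t r))
    {S : Set ℝ} (hS : ∀ᵐ z ∂π, T z ∈ S) (hm : ContinuousWithinAt m S t) {ε : ℝ} (hε : 0 < ε) :
    ∀ᶠ s in 𝓝[>] (0 : ℝ), ∫ z, K ((t - T z) / s) * |m (T z) - m t| ∂π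
      ≤ ε * ∫ z, K ((t - T z) / s) ∂π := by
  have hT := H.measurable_covariate
  obtain ⟨c, hc, hq⟩ := hK.exists_mul_le_integral hT hball
  obtain ⟨η, hη, hηm⟩ := Metric.continuousWithinAt_iff.1 hm (ε / 2) (by positivity)
  have htail : ∀ᶠ s in 𝓝[>] (0 : ℝ), η / s * K (η / s) < ε / 2 * c * η := by
    have h1 : Tendsto (fun s : ℝ => η / s) (𝓝[>] 0) atTop :=
      tendsto_inv_nhdsGT_zero.const_mul_atTop hη
    exact (hK.tendsto_mul.comp h1).eventually (gt_mem_nhds (by positivity))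
  filter_upwards [hq, htail, self_mem_nhdsWithin] with s hs htail (hs0 : 0 < s)
  have hint := hK.integrable_comp (π := π) hT t s
  have hKη : K (η / s) ≤ ε / 2 * (c * s) := by
    have h2 : η / s * K (η / s) ≤ η / s * (ε / 2 * (c * s)) := by
      refine htail.le.trans (le_of_eq ?_)
      field_simp
    exact le_of_mul_le_mul_left h2 (by positivity)
  have hle : ∀ᵐ z ∂π, K ((t - T z) / s) * |m (T z) - m t|
      ≤ ε / 2 * K ((t - T z) / s) + K (η / s) := by
    filter_upwards [hS] with z hz
    have hk := hK.nonneg ((t - T z) / s)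
    by_cases hd : dist (T z) t < η
    · have h3 := (hηm hz hd).le
      rw [Real.dist_eq] at h3
      nlinarith [hK.nonneg (η / s)]
    · have h3 : K ((t - T z) / s) ≤ K (η / s) := by
        refine hK.anti ?_
        rw [abs_div, abs_div, abs_of_pos hη, ← Real.dist_eq, dist_comm]
        gcongr
        exact not_lt.1 hd
      nlinarith [H.abs_regression_sub_le (T z) t, abs_nonneg (m (T z) - m t)]
  calc ∫ z, K ((t - T z) / s) * |m (T z) - m t| ∂π
      ≤ ∫ z, (ε / 2 * K ((t - T z) / s) + K (η / s)) ∂π :=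
        integral_mono_of_nonneg
          (ae_of_all _ fun z => mul_nonneg (hK.nonneg _) (abs_nonneg _))
          ((hint.const_mul _).add (integrable_const _)) hle
    _ = ε / 2 * ∫ z, K ((t - T z) / s) ∂π + K (η / s) := by
        rw [integral_add (hint.const_mul _) (integrable_const _), integral_const_mul]
        simp
    _ ≤ ε * ∫ z, K ((t - T z) / s) ∂π := by nlinarith

/-- The signed, `ε`-penalized kernel average `E[K((t - T) / s) (τ (A - m t) - ε)]`, `τ = ±1`, is
eventually at most `-ε / 2` times the mass of the kernel. -/
theorem IsRegularKernel.eventually_integral_penalized_le (hK : IsRegularKernel K)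
    (H : IsRegressionModel π T A m)
    (hball : ∃ c > 0, ∀ᶠ r in 𝓝[>] (0 : ℝ), c * r ≤ π.real (T ⁻¹' Metric.closedBall t r))
    {S : Set ℝ} (hS : ∀ᵐ z ∂π, T z ∈ S) (hm : ContinuousWithinAt m S t) {ε : ℝ} (hε : 0 < ε)
    {τ : ℝ} (hτ : |τ| = 1) :
    ∀ᶠ s in 𝓝[>] (0 : ℝ), ∫ z, K ((t - T z) / s) * (τ * (A z - m t) - ε) ∂π
      ≤ -(ε / 2 * ∫ z, K ((t - T z) / s) ∂π) := by
  have hT := H.measurable_covariate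
  filter_upwards [hK.eventually_integral_mul_abs_sub_le H hball hS hm (half_pos hε)] with s hs
  have hint := hK.integrable_comp (π := π) hT t s
  have hmeas : Measurable fun x => K ((t - x) / s) :=
    hK.measurable.comp ((measurable_id.const_sub t).div_const s)
  have hKb : ∀ x, |K ((t - x) / s)| ≤ K 0 := fun x => by
    rw [abs_of_nonneg (hK.nonneg _)]; exact hK.le_zero _
  have hmul : ∀ {g : α → ℝ}, Measurable g → (∀ z, |g z| ≤ 1) →
      Integrable (fun z => K ((t - T z) / s) * g z) π := fun hg hb =>
    hint.mul_bdd (c := 1) hg.aestronglyMeasurable (ae_of_all _ hb)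
  have hA : Integrable (fun z => K ((t - T z) / s) * A z) π :=
    hmul H.measurable_response fun z => by
      rw [abs_of_nonneg (H.response_mem z).1]; exact (H.response_mem z).2
  have hmT : Integrable (fun z => K ((t - T z) / s) * m (T z)) π :=
    hmul (H.measurable_regression.comp hT) fun z => by
      rw [abs_of_nonneg (H.regression_mem _).1]; exact (H.regression_mem _).2
  have h1 : ∫ z, K ((t - T z) / s) * (A z - m t) ∂π
      = ∫ z, K ((t - T z) / s) * (m (T z) - m t) ∂π := by
    simp only [mul_sub]
    rw [integral_sub hA (hint.mul_const _), integral_sub hmT (hint.mul_const _),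
      H.integral_mul_eq hmeas hKb]
  have h2 : |∫ z, K ((t - T z) / s) * (A z - m t) ∂π|
      ≤ ε / 2 * ∫ z, K ((t - T z) / s) ∂π := by
    rw [h1]
    refine (abs_integral_le_integral_abs).trans (le_trans (le_of_eq ?_) hs)
    refine integral_congr_ae (ae_of_all _ fun z => ?_)
    simp only [abs_mul, abs_of_nonneg (hK.nonneg _)]
  have hdiff : Integrable (fun z => K ((t - T z) / s) * (A z - m t)) π :=
    hmul (H.measurable_response.sub_const _) fun z => H.abs_response_sub_le z t
  have h3 : ∫ z, K ((t - T z) / s) * (τ * (A z - m t) - ε) ∂π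
      = τ * ∫ z, K ((t - T z) / s) * (A z - m t) ∂π - ε * ∫ z, K ((t - T z) / s) ∂π := by
    rw [← integral_const_mul, ← integral_const_mul,
      ← integral_sub (hdiff.const_mul _) (hint.const_mul _)]
    refine integral_congr_ae (ae_of_all _ fun z => ?_)
    ring
  have h4 : τ * ∫ z, K ((t - T z) / s) * (A z - m t) ∂π
      ≤ ε / 2 * ∫ z, K ((t - T z) / s) ∂π := by
    refine (le_abs_self _).trans ?_
    rw [abs_mul, hτ, one_mul]
    exact h2
  rw [h3]
  linarith

end KernelAverage

/-! ### One-sided Chebyshev inequality for product measures -/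

/-- If `f` has mean at most `-e` and `2 b ≤ n e`, then a sum of `n` independent copies of `f`
exceeds `-b` with probability at most `4 E[f²] / (n e²)`. -/
theorem measureReal_pi_neg_le_sum_le {α : Type*} [MeasurableSpace α] {π : Measure α}
    [IsProbabilityMeasure π] {f : α → ℝ} (hf : MemLp f 2 π) {n : ℕ} (hn : 0 < n) {b e : ℝ}
    (he : 0 < e) (hmean : ∫ z, f z ∂π ≤ -e) (hb : 2 * b ≤ n * e) :
    (Measure.pi fun _ : Fin n => π).real {z | -b ≤ ∑ i, f (z i)}
      ≤ 4 * (∫ z, f z ^ 2 ∂π) / (n * e ^ 2) := by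
  have hn' : (0 : ℝ) < n := by exact_mod_cast hn
  have hfi : ∀ i : Fin n, MemLp (fun z : Fin n → α => f (z i)) 2 (Measure.pi fun _ => π) :=
    fun i => hf.comp_measurePreserving (measurePreserving_eval _ i)
  have hsum : MemLp (∑ i : Fin n, fun z : Fin n → α => f (z i)) 2 (Measure.pi fun _ => π) :=
    memLp_finsetSum' _ fun i _ => hfi i
  have hE : ∫ z, (∑ i : Fin n, fun z : Fin n → α => f (z i)) z ∂(Measure.pi fun _ => π)
      = n * ∫ z, f z ∂π := by
    simp only [Finset.sum_apply]
    rw [integral_finsetSum _ fun i _ => (hfi i).integrable one_le_two]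
    have : ∀ i : Fin n, ∫ z : Fin n → α, f (z i) ∂(Measure.pi fun _ => π) = ∫ z, f z ∂π := by
      intro i
      have hmp := measurePreserving_eval (fun _ : Fin n => π) i
      have h := integral_map hmp.measurable.aemeasurable (f := f)
        (by rw [hmp.map_eq]; exact hf.aestronglyMeasurable)
      rw [hmp.map_eq] at h
      exact h.symm
    simp [this]
  have hV := variance_sum_pi (μ := fun _ : Fin n => π) (X := fun _ => f) fun _ => hf
  have hpos : 0 < n * e / 2 := by positivity
  have hcheb := meas_ge_le_variance_div_sq hsum hpos
  have hsub : {z : Fin n → α | -b ≤ ∑ i, f (z i)} ⊆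
      {z | n * e / 2 ≤ |(∑ i : Fin n, fun z : Fin n → α => f (z i)) z
        - ∫ z, (∑ i : Fin n, fun z : Fin n → α => f (z i)) z ∂(Measure.pi fun _ => π)|} := by
    intro z hz
    rw [mem_ofPred_eq] at hz ⊢
    rw [hE, Finset.sum_apply]
    refine le_trans ?_ (le_abs_self _)
    nlinarith
  refine (measureReal_mono hsub).trans ?_
  refine (ENNReal.toReal_le_of_le_ofReal (div_nonneg (variance_nonneg _ _) (sq_nonneg _))
    hcheb).trans ?_
  rw [hV]
  have hvar : Var[f; π] ≤ ∫ z, f z ^ 2 ∂π := variance_le_expectation_sq hf.aestronglyMeasurable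
  simp only [Finset.sum_const, Finset.card_univ, Fintype.card_fin, nsmul_eq_mul]
  calc n * Var[f; π] / (n * e / 2) ^ 2 = 4 * Var[f; π] / (n * e ^ 2) := by
        field_simp
        ring
    _ ≤ _ := by gcongr

/-! ### Pointwise consistency of kernel regression -/

/-- The kernel regression estimate at the covariate of `w`, from the sample consisting of `w`
and of the `n` further points `z j`. -/
noncomputable def centeredRegression {α : Type*} (K : ℝ → ℝ) (s : ℝ) (T A : α → ℝ) {n : ℕ} (w : α)
    (z : Fin n → α) : ℝ :=
  (K 0 * A w + ∑ j, K ((T w - T (z j)) / s) * A (z j)) / (K 0 + ∑ j, K ((T w - T (z j)) / s))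

theorem nadarayaWatson_eq_centeredRegression {α : Type*} (K : ℝ → ℝ) {s : ℝ} (hs : 0 < s)
    (T A : α → ℝ) {n : ℕ} (z : Fin (n + 1) → α) (i : Fin (n + 1)) :
    nadarayaWatson K s (fun j => T (z j)) (fun j => A (z j)) (T (z i))
      = centeredRegression K s T A (z i) (i.removeNth z) := by
  have hs' : (1 / s) ≠ 0 := by positivity
  simp only [nadarayaWatson, scaledKernel, mul_assoc]
  rw [← Finset.mul_sum, ← Finset.mul_sum, mul_div_mul_left _ _ hs', Fin.sum_univ_succAbove _ i,
    Fin.sum_univ_succAbove _ i]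
  simp only [sub_self, zero_div]
  rfl

theorem centeredRegression_denom_pos {α : Type*} {T : α → ℝ} {K : ℝ → ℝ} (hK : IsRegularKernel K)
    (s : ℝ) {n : ℕ} (w : α) (z : Fin n → α) : 0 < K 0 + ∑ j, K ((T w - T (z j)) / s) :=
  add_pos_of_pos_of_nonneg hK.zero_pos (Finset.sum_nonneg fun _ _ => hK.nonneg _)

section Consistency

variable {α : Type*} [MeasurableSpace α] {π : Measure α} {T A : α → ℝ} {m : ℝ → ℝ} {K : ℝ → ℝ}

theorem centeredRegression_mem (hK : IsRegularKernel K) (H : IsRegressionModel π T A m) (s : ℝ)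
    {n : ℕ} (w : α) (z : Fin n → α) : centeredRegression K s T A w z ∈ Icc (0 : ℝ) 1 := by
  have hD := centeredRegression_denom_pos (T := T) hK s w z
  refine ⟨div_nonneg (add_nonneg (mul_nonneg (hK.nonneg _) (H.response_mem w).1)
    (Finset.sum_nonneg fun j _ => mul_nonneg (hK.nonneg _) (H.response_mem (z j)).1)) hD.le, ?_⟩
  refine (div_le_one hD).2 (add_le_add ?_ (Finset.sum_le_sum fun j _ => ?_))
  · exact mul_le_of_le_one_right (hK.nonneg _) (H.response_mem w).2
  · exact mul_le_of_le_one_right (hK.nonneg _) (H.response_mem (z j)).2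

theorem measurable_centeredRegression (hK : IsRegularKernel K) (H : IsRegressionModel π T A m)
    (s : ℝ) (n : ℕ) :
    Measurable fun p : α × (Fin n → α) => centeredRegression K s T A p.1 p.2 := by
  have hT := H.measurable_covariate
  have hA := H.measurable_response
  have hKm := hK.measurable
  have hk : ∀ j : Fin n, Measurable fun p : α × (Fin n → α) => K ((T p.1 - T (p.2 j)) / s) := by
    intro j
    fun_prop
  refine ((measurable_const.mul (hA.comp measurable_fst)).add
    (Finset.measurable_sum _ fun j _ => (hk j).mul ?_)).div
    (measurable_const.add (Finset.measurable_sum _ fun j _ => hk j))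
  fun_prop

variable [IsProbabilityMeasure π]

/-- A deviation of the kernel regression estimate forces a penalized sum above `-K 0` (the
contribution of the central point); by Chebyshev's inequality this has vanishing probability as
soon as `n s → ∞`. -/
theorem tendsto_measureReal_neg_le_sum_penalized (hK : IsRegularKernel K)
    (H : IsRegressionModel π T A m) {t : ℝ}
    (hball : ∃ c > 0, ∀ᶠ r in 𝓝[>] (0 : ℝ), c * r ≤ π.real (T ⁻¹' Metric.closedBall t r))
    {S : Set ℝ} (hS : ∀ᵐ z ∂π, T z ∈ S) (hm : ContinuousWithinAt m S t) {ε : ℝ} (hε : 0 < ε)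
    {τ : ℝ} (hτ : |τ| = 1) {s : ℕ → ℝ} (hs0 : ∀ n, 0 < s n) (hs : Tendsto s atTop (𝓝 0))
    (hns : Tendsto (fun n : ℕ => n * s n) atTop atTop) :
    Tendsto (fun n : ℕ => (Measure.pi fun _ : Fin n => π).real
      {z | -K 0 ≤ ∑ i, K ((t - T (z i)) / s n) * (τ * (A (z i) - m t) - ε)}) atTop (𝓝 0) := by
  have hT := H.measurable_covariate
  have hs' : Tendsto s atTop (𝓝[>] 0) :=
    tendsto_nhdsWithin_iff.2 ⟨hs, Eventually.of_forall hs0⟩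
  obtain ⟨c, hc, hq⟩ := hK.exists_mul_le_integral hT hball
  have hq' := hs'.eventually hq
  have hpen := hs'.eventually (hK.eventually_integral_penalized_le H hball hS hm hε hτ)
  set q : ℕ → ℝ := fun n => ∫ z, K ((t - T z) / s n) ∂π with hqdef
  have hnq : Tendsto (fun n : ℕ => n * q n) atTop atTop := by
    refine tendsto_atTop_mono' _ ?_ (hns.const_mul_atTop hc)
    filter_upwards [hq'] with n hn
    calc c * (n * s n) = n * (c * s n) := by ring
      _ ≤ n * q n := by gcongr
  have hlim : Tendsto (fun n : ℕ => 16 * ((1 + ε) ^ 2 * K 0) / ε ^ 2 * (n * q n)⁻¹) atTop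
      (𝓝 0) := by
    simpa using (tendsto_inv_atTop_zero.comp hnq).const_mul (16 * ((1 + ε) ^ 2 * K 0) / ε ^ 2)
  refine tendsto_of_tendsto_of_tendsto_of_le_of_le' tendsto_const_nhds hlim
    (Eventually.of_forall fun n => measureReal_nonneg) ?_
  filter_upwards [hq', hpen, hnq.eventually_ge_atTop (4 * K 0 / ε), eventually_gt_atTop 0]
    with n hqn hpn hbig hn
  have hqpos : 0 < q n := (mul_pos hc (hs0 n)).trans_le hqn
  have hn' : (0 : ℝ) < n := by exact_mod_cast hn
  set f : α → ℝ := fun z => K ((t - T z) / s n) * (τ * (A z - m t) - ε) with hf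
  have hfac : ∀ z, |τ * (A z - m t) - ε| ≤ 1 + ε := fun z => by
    refine (abs_sub _ _).trans ?_
    rw [abs_mul, hτ, one_mul, abs_of_pos hε]
    linarith [H.abs_response_sub_le z t]
  have hfm : Measurable f :=
    (hK.measurable.comp ((hT.const_sub t).div_const _)).mul
      (((H.measurable_response.sub_const _).const_mul τ).sub_const ε)
  have hfb : MemLp f 2 π := by
    refine MemLp.of_bound hfm.aestronglyMeasurable (K 0 * (1 + ε)) (ae_of_all _ fun z => ?_)
    rw [Real.norm_eq_abs, hf, abs_mul, abs_of_nonneg (hK.nonneg _)]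
    exact mul_le_mul (hK.le_zero _) (hfac z) (abs_nonneg _) (hK.nonneg _)
  have hsq : ∫ z, f z ^ 2 ∂π ≤ (1 + ε) ^ 2 * K 0 * q n := by
    rw [hqdef, ← integral_const_mul]
    refine integral_mono hfb.integrable_sq ((hK.integrable_comp hT t _).const_mul _) fun z => ?_
    have h1 : (τ * (A z - m t) - ε) ^ 2 ≤ (1 + ε) ^ 2 := by
      rw [← sq_abs]
      exact pow_le_pow_left₀ (abs_nonneg _) (hfac z) 2
    have h2 : K ((t - T z) / s n) ^ 2 ≤ K 0 * K ((t - T z) / s n) := by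
      rw [sq]
      exact mul_le_mul_of_nonneg_right (hK.le_zero _) (hK.nonneg _)
    calc f z ^ 2 = K ((t - T z) / s n) ^ 2 * (τ * (A z - m t) - ε) ^ 2 := mul_pow _ _ _
      _ ≤ (K 0 * K ((t - T z) / s n)) * (1 + ε) ^ 2 :=
          mul_le_mul h2 h1 (sq_nonneg _) (mul_nonneg hK.zero_pos.le (hK.nonneg _))
      _ = (1 + ε) ^ 2 * K 0 * K ((t - T z) / s n) := by ring
  have hb : 2 * K 0 ≤ n * (ε / 2 * q n) := by
    rw [div_le_iff₀ hε] at hbig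
    linarith
  refine (measureReal_pi_neg_le_sum_le hfb hn (by positivity) hpn hb).trans ?_
  calc 4 * (∫ z, f z ^ 2 ∂π) / (n * (ε / 2 * q n) ^ 2)
      ≤ 4 * ((1 + ε) ^ 2 * K 0 * q n) / (n * (ε / 2 * q n) ^ 2) := by gcongr
    _ = 16 * ((1 + ε) ^ 2 * K 0) / ε ^ 2 * (n * q n)⁻¹ := by
        field_simp
        ring

/-- Consistency of kernel regression at a fixed design point: the regression function is continuous
there, and the covariate charges small balls around it. -/
theorem tendsto_measureReal_le_abs_centeredRegression_sub (hK : IsRegularKernel K)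
    (H : IsRegressionModel π T A m) {w : α}
    (hball : ∃ c > 0, ∀ᶠ r in 𝓝[>] (0 : ℝ), c * r ≤ π.real (T ⁻¹' Metric.closedBall (T w) r))
    {S : Set ℝ} (hS : ∀ᵐ z ∂π, T z ∈ S) (hm : ContinuousWithinAt m S (T w)) {ε : ℝ} (hε : 0 < ε)
    {s : ℕ → ℝ} (hs0 : ∀ n, 0 < s n) (hs : Tendsto s atTop (𝓝 0))
    (hns : Tendsto (fun n : ℕ => n * s n) atTop atTop) :
    Tendsto (fun n : ℕ => (Measure.pi fun _ : Fin n => π).real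
      {z | ε ≤ |centeredRegression K (s n) T A w z - m (T w)|}) atTop (𝓝 0) := by
  have h1 := tendsto_measureReal_neg_le_sum_penalized hK H hball hS hm hε (τ := 1) (by simp)
    hs0 hs hns
  have h2 := tendsto_measureReal_neg_le_sum_penalized hK H hball hS hm hε (τ := -1) (by simp)
    hs0 hs hns
  have h12 := h1.add h2
  rw [add_zero] at h12
  refine squeeze_zero (fun n => measureReal_nonneg) (fun n => ?_) h12
  refine (measureReal_mono ?_).trans (measureReal_union_le _ _)
  intro z hz
  have hz : ε ≤ |centeredRegression K (s n) T A w z - m (T w)| := hz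
  have hD := centeredRegression_denom_pos (T := T) hK (s n) w z
  have key : ∀ τ : ℝ, |τ| = 1 → ε ≤ τ * (centeredRegression K (s n) T A w z - m (T w)) →
      -K 0 ≤ ∑ i, K ((T w - T (z i)) / s n) * (τ * (A (z i) - m (T w)) - ε) := by
    intro τ hτ hle
    have e1 : τ * (centeredRegression K (s n) T A w z - m (T w)) *
        (K 0 + ∑ j, K ((T w - T (z j)) / s n))
        = τ * (K 0 * (A w - m (T w))
          + ∑ j, K ((T w - T (z j)) / s n) * (A (z j) - m (T w))) := by
      unfold centeredRegression
      simp only [mul_sub, Finset.sum_sub_distrib, ← Finset.sum_mul]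
      field_simp
      ring
    have e2 : ∑ i, K ((T w - T (z i)) / s n) * (τ * (A (z i) - m (T w)) - ε)
        = τ * (∑ j, K ((T w - T (z j)) / s n) * (A (z j) - m (T w)))
          - ε * ∑ j, K ((T w - T (z j)) / s n) := by
      rw [Finset.mul_sum, Finset.mul_sum, ← Finset.sum_sub_distrib]
      exact Finset.sum_congr rfl fun j _ => by ring
    have e3 := mul_le_mul_of_nonneg_right hle hD.le
    have e4 : τ * (K 0 * (A w - m (T w))) ≤ K 0 := by
      refine (le_abs_self _).trans ?_
      rw [abs_mul, hτ, one_mul, abs_mul, abs_of_pos hK.zero_pos]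
      exact mul_le_of_le_one_right hK.zero_pos.le (H.abs_response_sub_le w _)
    have e5 : 0 < ε * K 0 := mul_pos hε hK.zero_pos
    rw [e1] at e3
    rw [e2]
    nlinarith
  rcases le_abs.1 hz with h | h
  · exact Or.inl (key 1 (by simp) (by linarith))
  · exact Or.inr (key (-1) (by simp) (by linarith))

/-- Convergence in probability passes to convergence in mean of a continuous function of the
estimate, because the estimate stays in `[0, 1]`. -/
theorem tendsto_lintegral_comp_centeredRegression_sub (hK : IsRegularKernel K)
    (H : IsRegressionModel π T A m) {w : α}
    (hball : ∃ c > 0, ∀ᶠ r in 𝓝[>] (0 : ℝ), c * r ≤ π.real (T ⁻¹' Metric.closedBall (T w) r))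
    {S : Set ℝ} (hS : ∀ᵐ z ∂π, T z ∈ S) (hm : ContinuousWithinAt m S (T w))
    {s : ℕ → ℝ} (hs0 : ∀ n, 0 < s n) (hs : Tendsto s atTop (𝓝 0))
    (hns : Tendsto (fun n : ℕ => n * s n) atTop atTop)
    {f : ℝ → ℝ} (hf : Continuous f) {C : ℝ} (hC : ∀ x ∈ Icc (0 : ℝ) 1, |f x| ≤ C) :
    Tendsto (fun n : ℕ => ∫⁻ z, ENNReal.ofReal
      |f (centeredRegression K (s n) T A w z) - f (m (T w))| ∂(Measure.pi fun _ : Fin n => π))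
      atTop (𝓝 0) := by
  have hC0 : 0 ≤ C := (abs_nonneg _).trans (hC 0 (by simp))
  rw [ENNReal.tendsto_nhds_zero]
  intro ε hε
  obtain ⟨e, he, heε⟩ : ∃ e : ℝ, 0 < e ∧ ENNReal.ofReal e ≤ ε := by
    rcases eq_or_ne ε ∞ with h | h
    · exact ⟨1, one_pos, h ▸ le_top⟩
    · exact ⟨ε.toReal, ENNReal.toReal_pos hε.ne' h, (ENNReal.ofReal_toReal h).le⟩
  obtain ⟨η, hη, hfη⟩ := Metric.continuous_iff.1 hf (m (T w)) (e / 2) (half_pos he)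
  have hlim := tendsto_measureReal_le_abs_centeredRegression_sub hK H hball hS hm hη hs0 hs hns
  have hlim2 : Tendsto (fun n : ℕ => 2 * C * (Measure.pi fun _ : Fin n => π).real
      {z | η ≤ |centeredRegression K (s n) T A w z - m (T w)|}) atTop (𝓝 0) := by
    simpa using hlim.const_mul (2 * C)
  filter_upwards [hlim2.eventually (gt_mem_nhds (half_pos he))] with n hn
  have hmeas : Measurable fun z : Fin n → α => centeredRegression K (s n) T A w z :=
    (measurable_centeredRegression hK H (s n) n).comp measurable_prodMk_left
  set B : Set (Fin n → α) := {z | η ≤ |centeredRegression K (s n) T A w z - m (T w)|} with hB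
  have hBm : MeasurableSet B :=
    measurableSet_le measurable_const (measurable_abs.comp (hmeas.sub_const _))
  calc ∫⁻ z, ENNReal.ofReal (|f (centeredRegression K (s n) T A w z) - f (m (T w))|)
        ∂(Measure.pi fun _ : Fin n => π)
      ≤ ∫⁻ z, (ENNReal.ofReal (e / 2) + B.indicator (fun _ => ENNReal.ofReal (2 * C)) z)
          ∂(Measure.pi fun _ : Fin n => π) := by
        refine lintegral_mono fun z => ?_
        by_cases hz : z ∈ B
        · rw [indicator_of_mem hz]
          refine le_add_left (ENNReal.ofReal_le_ofReal ?_)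
          refine (abs_sub _ _).trans ?_
          linarith [hC _ (centeredRegression_mem hK H (s n) w z), hC _ (H.regression_mem (T w))]
        · refine le_add_right (ENNReal.ofReal_le_ofReal ?_)
          have := hfη (centeredRegression K (s n) T A w z) (by rw [Real.dist_eq]; exact not_le.1 hz)
          rw [Real.dist_eq] at this
          exact this.le
    _ = ENNReal.ofReal (e / 2 + 2 * C * (Measure.pi fun _ : Fin n => π).real B) := by
        rw [lintegral_add_left measurable_const, lintegral_const, measure_univ, mul_one,
          lintegral_indicator_const hBm, ENNReal.ofReal_add (by positivity) (by positivity),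
          ENNReal.ofReal_mul (p := 2 * C) (by positivity), ofReal_measureReal]
    _ ≤ ENNReal.ofReal e := ENNReal.ofReal_le_ofReal (by linarith)
    _ ≤ ε := heε

/-- The mean over the sample points of the error of `f` of the kernel regression estimate tends to
`0` in mean. All summands have the same law, so only the estimate at one random design point
matters, and almost every design point is good. -/
theorem tendsto_lintegral_pluginError (hK : IsRegularKernel K) (H : IsRegressionModel π T A m)
    (hball : ∀ᵐ w ∂π, ∃ c > 0, ∀ᶠ r in 𝓝[>] (0 : ℝ),
      c * r ≤ π.real (T ⁻¹' Metric.closedBall (T w) r))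
    {S : Set ℝ} (hS : ∀ᵐ z ∂π, T z ∈ S) (hm : ContinuousOn m S)
    {s : ℕ → ℝ} (hs0 : ∀ n, 0 < s n) (hs : Tendsto s atTop (𝓝 0))
    (hns : Tendsto (fun n : ℕ => n * s n) atTop atTop)
    {f : ℝ → ℝ} (hf : Continuous f) {C : ℝ} (hC : ∀ x ∈ Icc (0 : ℝ) 1, |f x| ≤ C) :
    Tendsto (fun n : ℕ => ∫⁻ z, ENNReal.ofReal ((1 / (n : ℝ)) * ∑ i,
      |f (nadarayaWatson K (s n) (fun j => T (z j)) (fun j => A (z j)) (T (z i)))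
        - f (m (T (z i)))|) ∂(Measure.pi fun _ : Fin n => π)) atTop (𝓝 0) := by
  rw [← tendsto_add_atTop_iff_nat 1]
  -- the error at the design point `p.1`, when the `n` other sample points are `p.2`
  set G : (n : ℕ) → α × (Fin n → α) → ℝ≥0∞ := fun n p => ENNReal.ofReal
    |f (centeredRegression K (s (n + 1)) T A p.1 p.2) - f (m (T p.1))| with hG
  have hGm : ∀ n, Measurable (G n) := fun n =>
    (measurable_abs.comp ((hf.measurable.comp (measurable_centeredRegression hK H _ n)).sub
      (hf.measurable.comp (H.measurable_regression.comp
        (H.measurable_covariate.comp measurable_fst))))).ennreal_ofReal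
  have heq : ∀ n : ℕ, ∫⁻ z, ENNReal.ofReal ((1 / ((n + 1 : ℕ) : ℝ)) * ∑ i,
      |f (nadarayaWatson K (s (n + 1)) (fun j => T (z j)) (fun j => A (z j)) (T (z i)))
        - f (m (T (z i)))|) ∂(Measure.pi fun _ : Fin (n + 1) => π)
      = ∫⁻ w, ∫⁻ z, G n (w, z) ∂(Measure.pi fun _ : Fin n => π) ∂π := by
    intro n
    have hmp : ∀ i : Fin (n + 1), MeasurePreserving
        (fun z : Fin (n + 1) → α => (z i, i.removeNth z)) (Measure.pi fun _ => π)
        (π.prod (Measure.pi fun _ => π)) :=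
      fun i => measurePreserving_piFinSuccAbove (fun _ => π) i
    have hGi : ∀ i : Fin (n + 1), Measurable fun z : Fin (n + 1) → α => G n (z i, i.removeNth z) :=
      fun i => (hGm n).comp (hmp i).measurable
    have hn : (0 : ℝ) < ((n + 1 : ℕ) : ℝ) := by positivity
    calc _ = ∫⁻ z, ENNReal.ofReal (1 / ((n + 1 : ℕ) : ℝ)) * ∑ i : Fin (n + 1),
          G n (z i, i.removeNth z) ∂(Measure.pi fun _ : Fin (n + 1) => π) := by
          refine lintegral_congr fun z => ?_
          rw [ENNReal.ofReal_mul (by positivity),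
            ENNReal.ofReal_sum_of_nonneg fun i _ => abs_nonneg _]
          simp only [nadarayaWatson_eq_centeredRegression K (hs0 (n + 1)) T A, hG]
      _ = ENNReal.ofReal (1 / ((n + 1 : ℕ) : ℝ)) * ∑ i : Fin (n + 1),
          ∫⁻ p, G n p ∂(π.prod (Measure.pi fun _ : Fin n => π)) := by
          rw [lintegral_const_mul _ (Finset.measurable_sum _ fun i _ => hGi i),
            lintegral_finsetSum _ fun i _ => hGi i]
          congr 1
          exact Finset.sum_congr rfl fun i _ => (hmp i).lintegral_comp (hGm n)
      _ = ∫⁻ p, G n p ∂(π.prod (Measure.pi fun _ : Fin n => π)) := by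
          rw [Finset.sum_const, Finset.card_univ, Fintype.card_fin, nsmul_eq_mul, ← mul_assoc,
            ← ENNReal.ofReal_natCast, ← ENNReal.ofReal_mul (by positivity),
            one_div_mul_cancel hn.ne', ENNReal.ofReal_one, one_mul]
      _ = _ := lintegral_prod _ (hGm n).aemeasurable
  simp only [heq]
  have hns' : Tendsto (fun n : ℕ => n * s (n + 1)) atTop atTop := by
    have h1 : Tendsto (fun n : ℕ => ((n + 1 : ℕ) : ℝ) * s (n + 1) - s (n + 1)) atTop atTop := by
      have h2 := (hns.comp (tendsto_add_atTop_nat 1)).atTop_add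
        ((hs.comp (tendsto_add_atTop_nat 1)).neg)
      refine h2.congr fun n => ?_
      simp [sub_eq_add_neg]
    refine h1.congr fun n => ?_
    push_cast
    ring
  have hbound : ∀ n p, G n p ≤ ENNReal.ofReal (2 * C) := fun n p => by
    refine ENNReal.ofReal_le_ofReal ((abs_sub _ _).trans ?_)
    linarith [hC _ (centeredRegression_mem hK H (s (n + 1)) p.1 p.2),
      hC _ (H.regression_mem (T p.1))]
  have hdc := tendsto_lintegral_of_dominated_convergence (μ := π)
    (F := fun n w => ∫⁻ z, G n (w, z) ∂(Measure.pi fun _ : Fin n => π)) (f := fun _ => 0)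
    (fun _ => ENNReal.ofReal (2 * C)) (fun n => (hGm n).lintegral_prod_right')
    (fun n => ae_of_all _ fun w => (lintegral_mono fun z => hbound n (w, z)).trans (by simp))
    (by rw [lintegral_const, measure_univ, mul_one]; exact ENNReal.ofReal_ne_top) (by
      filter_upwards [hball, hS] with w hw hwS
      exact tendsto_lintegral_comp_centeredRegression_sub hK H hw hS (hm _ hwS)
        (fun n => hs0 (n + 1)) (hs.comp (tendsto_add_atTop_nat 1)) hns' hf hC)
  simpa using hdc

end Consistency

/-! ### Mass of small balls under a density -/

/-- By Lebesgue differentiation, almost every value of a real variable with a density has small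
balls around it whose mass is at least proportional to their radius. -/
theorem ae_exists_mul_le_measureReal_closedBall {α : Type*} [MeasurableSpace α] {π : Measure α}
    [IsProbabilityMeasure π] {T : α → ℝ} (hT : Measurable T) (hac : π.map T ≪ volume) :
    ∀ᵐ w ∂π, ∃ c > 0, ∀ᶠ r in 𝓝[>] (0 : ℝ),
      c * r ≤ π.real (T ⁻¹' Metric.closedBall (T w) r) := by
  have : IsProbabilityMeasure (π.map T) := Measure.isProbabilityMeasure_map hT.aemeasurable
  refine ae_of_ae_map hT.aemeasurable (p := fun t => ∃ c > 0, ∀ᶠ r in 𝓝[>] (0 : ℝ),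
      c * r ≤ π.real (T ⁻¹' Metric.closedBall t r)) ?_
  filter_upwards [hac.ae_le (Besicovitch.ae_tendsto_rnDeriv (π.map T) (volume : Measure ℝ)),
    Measure.rnDeriv_pos hac] with t ht hpos
  obtain ⟨c, hc0, hc⟩ := ENNReal.lt_iff_exists_nnreal_btwn.1 hpos
  refine ⟨2 * c, by have : 0 < c := by exact_mod_cast hc0
                    positivity, ?_⟩
  filter_upwards [ht.eventually (lt_mem_nhds hc), self_mem_nhdsWithin] with r hr (hr0 : 0 < r)
  rw [Real.volume_closedBall, ENNReal.lt_div_iff_mul_lt (Or.inl (by simpa using hr0))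
    (Or.inl ENNReal.ofReal_ne_top), Measure.map_apply hT Metric.isClosed_closedBall.measurableSet]
    at hr
  have := ENNReal.toReal_mono (measure_ne_top _ _) hr.le
  rw [ENNReal.toReal_mul, ENNReal.toReal_ofReal (by positivity), ENNReal.coe_toReal] at this
  calc 2 * (c : ℝ) * r = c * (2 * r) := by ring
    _ ≤ _ := this

/-! ### Laws of large numbers in probability -/

section LLN

variable {α : Type*} [MeasurableSpace α] {π : Measure α} {Ω : Type*} [MeasurableSpace Ω]
  {P : Measure Ω} [IsProbabilityMeasure P] {Z : ℕ → Ω → α}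

theorem tendstoInMeasure_average (hZ : ∀ i, Measurable (Z i)) (hZ_indep : iIndepFun Z P)
    (hZ_law : ∀ i, P.map (Z i) = π) {X : α → ℝ} (hX : Measurable X) (hXi : Integrable X π) :
    TendstoInMeasure P (fun (n : ℕ) ω => (1 / (n : ℝ)) * ∑ i : Fin n, X (Z i ω)) atTop
      (fun _ => ∫ z, X z ∂π) := by
  refine tendstoInMeasure_of_tendsto_ae (fun n => ?_) ?_
  · exact ((Finset.measurable_sum Finset.univ fun (i : Fin n) _ =>
      hX.comp (hZ i)).const_mul (1 / (n : ℝ))).aestronglyMeasurable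
  have hid : ∀ i, IdentDistrib (fun ω => X (Z i ω)) (fun ω => X (Z 0 ω)) P P := fun i =>
    (IdentDistrib.mk (hZ i).aemeasurable (hZ 0).aemeasurable
      ((hZ_law i).trans (hZ_law 0).symm)).comp hX
  have hint : Integrable (fun ω => X (Z 0 ω)) P := by
    rw [← hZ_law 0] at hXi
    exact hXi.comp_measurable (hZ 0)
  have hind : iIndepFun (fun i ω => X (Z i ω)) P := hZ_indep.comp (fun _ => X) fun _ => hX
  have hE : ∫ ω, X (Z 0 ω) ∂P = ∫ z, X z ∂π := by
    rw [← hZ_law 0, integral_map (hZ 0).aemeasurable hX.aestronglyMeasurable]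
  filter_upwards [strong_law_ae_real (fun i ω => X (Z i ω)) hint
    (fun i j hij => hind.indepFun hij) hid] with ω hω
  rw [hE] at hω
  refine hω.congr fun n => ?_
  rw [Finset.sum_range, one_div, div_eq_inv_mul]

variable [IsProbabilityMeasure π]

theorem integrable_min_const {X : α → ℝ} (hX : Measurable X) {B : ℝ} (hB0 : 0 ≤ B)
    (hB : ∀ᵐ z ∂π, -B ≤ X z) (N : ℕ) : Integrable (fun z => min (X z) N) π := by
  refine Integrable.of_bound (hX.min measurable_const).aestronglyMeasurable (max B N) ?_
  filter_upwards [hB] with z hz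
  have h1 := le_max_left B (N : ℝ)
  have h2 := le_max_right B (N : ℝ)
  have h3 : (0 : ℝ) ≤ N := N.cast_nonneg
  rw [Real.norm_eq_abs, abs_le]
  exact ⟨le_min (by linarith) (by linarith), (min_le_right _ _).trans h2⟩

/-- A variable bounded below whose truncations have bounded expectations is integrable. -/
theorem integrable_of_integral_min_le {X : α → ℝ} (hX : Measurable X) {B M : ℝ} (hB0 : 0 ≤ B)
    (hB : ∀ᵐ z ∂π, -B ≤ X z) (hM : ∀ N : ℕ, ∫ z, min (X z) N ∂π ≤ M) : Integrable X π := by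
  have hint := integrable_min_const hX hB0 hB
  have hlim := lintegral_tendsto_of_tendsto_of_monotone (μ := π)
    (f := fun (N : ℕ) z => ENNReal.ofReal (min (X z) N + B))
    (F := fun z => ENNReal.ofReal (X z + B))
    (fun N => ((hX.min measurable_const).add_const B).ennreal_ofReal.aemeasurable)
    (ae_of_all _ fun z N N' h => ENNReal.ofReal_le_ofReal (by gcongr))
    (ae_of_all _ fun z => by
      obtain ⟨N₀, hN₀⟩ := exists_nat_ge (X z)
      refine tendsto_const_nhds.congr' ?_
      filter_upwards [eventually_ge_atTop N₀] with N hN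
      rw [min_eq_left (hN₀.trans (by exact_mod_cast hN))])
  have hle : ∫⁻ z, ENNReal.ofReal (X z + B) ∂π ≤ ENNReal.ofReal (M + B) := by
    refine le_of_tendsto hlim (Eventually.of_forall fun N => ?_)
    have hadd : Integrable (fun z => min (X z) N + B) π := (hint N).add (integrable_const B)
    rw [← ofReal_integral_eq_lintegral_ofReal hadd]
    · refine ENNReal.ofReal_le_ofReal ?_
      rw [integral_add (hint N) (integrable_const _)]
      simpa using hM N
    · filter_upwards [hB] with z hz
      have h1 : -B ≤ min (X z) N := le_min hz (by linarith [N.cast_nonneg (α := ℝ)])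
      simp only [Pi.zero_apply]
      linarith
  have h1 : Integrable (fun z => X z + B) π := by
    rw [← lintegral_ofReal_ne_top_iff_integrable (hX.add_const B).aestronglyMeasurable]
    · exact (hle.trans_lt ENNReal.ofReal_lt_top).ne
    · filter_upwards [hB] with z hz
      simp only [Pi.zero_apply]
      linarith
  refine (h1.sub (integrable_const B)).congr (ae_of_all _ fun z => ?_)
  simp

/-- Law of large numbers with infinite mean: averages of a non-integrable variable that is bounded
below tend to `∞` in probability. -/
theorem tendsto_measure_average_le (hZ : ∀ i, Measurable (Z i)) (hZ_indep : iIndepFun Z P)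
    (hZ_law : ∀ i, P.map (Z i) = π) {X : α → ℝ} (hX : Measurable X) {B : ℝ}
    (hB0 : 0 ≤ B) (hB : ∀ᵐ z ∂π, -B ≤ X z) (hXi : ¬ Integrable X π) (M : ℝ) :
    Tendsto (fun n : ℕ => P {ω | (1 / (n : ℝ)) * ∑ i : Fin n, X (Z i ω) ≤ M}) atTop (𝓝 0) := by
  obtain ⟨N, hN⟩ : ∃ N : ℕ, M + 1 < ∫ z, min (X z) N ∂π := by
    by_contra! hcon
    exact hXi (integrable_of_integral_min_le hX hB0 hB hcon)
  have hint := integrable_min_const hX hB0 hB N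
  have hlln := tendstoInMeasure_iff_dist.1 (tendstoInMeasure_average hZ hZ_indep hZ_law
    (hX.min measurable_const) hint) 1 one_pos
  refine tendsto_of_tendsto_of_tendsto_of_le_of_le tendsto_const_nhds hlln
    (fun _ => zero_le) fun n => measure_mono fun ω hω => ?_
  have hω : (1 / (n : ℝ)) * ∑ i : Fin n, X (Z i ω) ≤ M := hω
  have hmin : (1 / (n : ℝ)) * ∑ i : Fin n, min (X (Z i ω)) N
      ≤ (1 / (n : ℝ)) * ∑ i : Fin n, X (Z i ω) :=
    mul_le_mul_of_nonneg_left (Finset.sum_le_sum fun i _ => min_le_left _ _) (by positivity)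
  change (1 : ℝ) ≤ dist ((1 / (n : ℝ)) * ∑ i : Fin n, min (X (Z i ω)) N) (∫ z, min (X z) N ∂π)
  rw [Real.dist_eq, abs_sub_comm]
  exact le_trans (by linarith) (le_abs_self _)

end LLN

/-! ### Conditioning the linear part of the divergence -/

section Divergence

variable {α : Type*} [MeasurableSpace α] {π : Measure α} {T A : α → ℝ} {m φ f : ℝ → ℝ}

theorem IsBregmanGenerator.ae_le_summand (hφ : IsBregmanGenerator φ)
    (hfφ : EqOn f φ (Icc 0 1)) (H : IsRegressionModel π T A m)
    (hIoo : ∀ᵐ z ∂π, T z ∈ Ioo (0 : ℝ) 1) {C : ℝ} (hC : ∀ t ∈ Icc (0 : ℝ) 1, |φ t| ≤ C) :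
    ∀ᵐ z ∂π, -(2 * C) ≤ f (m (T z)) - f (T z) - deriv φ (T z) * (A z - T z) := by
  filter_upwards [hIoo] with z hz
  have h1 := hφ.bregman_nonneg (H.response_mem z) hz
  rw [bregman, derivUnit_eq_deriv hz] at h1
  have h2 := abs_le.1 (hC _ (H.response_mem z))
  have h3 := abs_le.1 (hC _ (H.regression_mem (T z)))
  rw [hfφ (H.regression_mem (T z)), hfφ (Ioo_subset_Icc_self hz)]
  linarith [h2.2, h3.1]

variable [IsProbabilityMeasure π]

/-- A nonnegative mixture `a(T) A + b(T) (1 - A)` has the same expectation, finite or not, as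
`a(T) m(T) + b(T) (1 - m(T))`. -/
theorem IsRegressionModel.lintegral_mixture_eq (H : IsRegressionModel π T A m) {a b : ℝ → ℝ}
    (ha : Measurable a) (hb : Measurable b) (ha0 : ∀ᵐ z ∂π, 0 ≤ a (T z))
    (hb0 : ∀ᵐ z ∂π, 0 ≤ b (T z)) :
    ∫⁻ z, ENNReal.ofReal (a (T z) * A z + b (T z) * (1 - A z)) ∂π
      = ∫⁻ z, ENNReal.ofReal (a (T z) * m (T z) + b (T z) * (1 - m (T z))) ∂π := by
  have hT := H.measurable_covariate
  have hA := H.measurable_response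
  have hm := H.measurable_regression
  have split : ∀ Y : α → ℝ, Measurable Y → (∀ z, Y z ∈ Icc (0 : ℝ) 1) →
      ∫⁻ z, ENNReal.ofReal (a (T z) * Y z + b (T z) * (1 - Y z)) ∂π
      = ∫⁻ z, ENNReal.ofReal (a (T z)) * ENNReal.ofReal (Y z) ∂π
        + ∫⁻ z, ENNReal.ofReal (b (T z)) * ENNReal.ofReal (1 - Y z) ∂π := by
    intro Y hY hYm
    rw [← lintegral_add_left (by fun_prop)]
    refine lintegral_congr_ae ?_
    filter_upwards [ha0, hb0] with z h1 h2
    rw [ENNReal.ofReal_add (mul_nonneg h1 (hYm z).1)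
      (mul_nonneg h2 (sub_nonneg.2 (hYm z).2)), ENNReal.ofReal_mul h1, ENNReal.ofReal_mul h2]
  rw [split A hA H.response_mem, split (fun z => m (T z)) (hm.comp hT) fun z => H.regression_mem _,
    H.lintegral_mul_eq ha.ennreal_ofReal, H.one_sub.lintegral_mul_eq hb.ennreal_ofReal]

/-- The same comparison for integrability and Bochner integrals. -/
theorem IsRegressionModel.integrable_mixture_iff (H : IsRegressionModel π T A m) {a b : ℝ → ℝ}
    (ha : Measurable a) (hb : Measurable b) (ha0 : ∀ᵐ z ∂π, 0 ≤ a (T z))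
    (hb0 : ∀ᵐ z ∂π, 0 ≤ b (T z)) :
    (Integrable (fun z => a (T z) * A z + b (T z) * (1 - A z)) π
      ↔ Integrable (fun z => a (T z) * m (T z) + b (T z) * (1 - m (T z))) π) ∧
    ∫ z, (a (T z) * A z + b (T z) * (1 - A z)) ∂π
      = ∫ z, (a (T z) * m (T z) + b (T z) * (1 - m (T z))) ∂π := by
  have hT := H.measurable_covariate
  have hA := H.measurable_response
  have hm := H.measurable_regression
  have hnn : ∀ Y : α → ℝ, (∀ z, Y z ∈ Icc (0 : ℝ) 1) →
      0 ≤ᵐ[π] fun z => a (T z) * Y z + b (T z) * (1 - Y z) := by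
    intro Y hY
    filter_upwards [ha0, hb0] with z h1 h2
    exact add_nonneg (mul_nonneg h1 (hY z).1) (mul_nonneg h2 (sub_nonneg.2 (hY z).2))
  have m1 : Measurable fun z => a (T z) * A z + b (T z) * (1 - A z) := by fun_prop
  have m2 : Measurable fun z => a (T z) * m (T z) + b (T z) * (1 - m (T z)) := by fun_prop
  have n1 := hnn A H.response_mem
  have n2 := hnn (fun z => m (T z)) fun z => H.regression_mem _
  constructor
  · rw [← lintegral_ofReal_ne_top_iff_integrable m1.aestronglyMeasurable n1,
      ← lintegral_ofReal_ne_top_iff_integrable m2.aestronglyMeasurable n2,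
      H.lintegral_mixture_eq ha hb ha0 hb0]
  · rw [integral_eq_lintegral_of_nonneg_ae n1 m1.aestronglyMeasurable,
      integral_eq_lintegral_of_nonneg_ae n2 m2.aestronglyMeasurable,
      H.lintegral_mixture_eq ha hb ha0 hb0]

/-- Replacing the response by its regression function in the term `φ'(T) (A - T)` changes neither
integrability nor the expectation, although `φ'(T)` itself need not be integrable. Up to bounded
terms both variables are mixtures of the nonnegative divergences `d_φ(1, T)` and `d_φ(0, T)`. The
function `f` is a continuous extension of `φ`. -/
theorem IsBregmanGenerator.integrable_summand_iff (hφ : IsBregmanGenerator φ) (hf : Continuous f)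
    (hfφ : EqOn f φ (Icc 0 1)) (H : IsRegressionModel π T A m)
    (hIoo : ∀ᵐ z ∂π, T z ∈ Ioo (0 : ℝ) 1) :
    (Integrable (fun z => f (m (T z)) - f (T z) - deriv φ (T z) * (A z - T z)) π
      ↔ Integrable (fun z => f (m (T z)) - f (T z) - deriv φ (T z) * (m (T z) - T z)) π) ∧
    ∫ z, (f (m (T z)) - f (T z) - deriv φ (T z) * (A z - T z)) ∂π
      = ∫ z, (f (m (T z)) - f (T z) - deriv φ (T z) * (m (T z) - T z)) ∂π := by
  have hT := H.measurable_covariate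
  have hA := H.measurable_response
  have hm := H.measurable_regression
  have hfm := hf.measurable
  have hd : Measurable (deriv φ) := measurable_deriv φ
  obtain ⟨C, -, hC⟩ := hφ.exists_abs_le
  have hfC : ∀ x ∈ Icc (0 : ℝ) 1, |f x| ≤ C := fun x hx => by rw [hfφ hx]; exact hC x hx
  have h0I : (0 : ℝ) ∈ Icc (0 : ℝ) 1 := by simp
  have h1I : (1 : ℝ) ∈ Icc (0 : ℝ) 1 := by simp
  -- the divergence `d_φ(x, t)`, in a form that is measurable in `t` on the whole line
  set v : ℝ → ℝ → ℝ := fun x t => f x - f t - deriv φ t * (x - t) with hv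
  have hvm : ∀ x, Measurable (v x) := fun x => by
    simp only [hv]
    fun_prop
  have hv0 : ∀ x ∈ Icc (0 : ℝ) 1, ∀ᵐ z ∂π, 0 ≤ v x (T z) := fun x hx => by
    filter_upwards [hIoo] with z hz
    have := hφ.bregman_nonneg hx hz
    rwa [bregman, derivUnit_eq_deriv hz, ← hfφ hx, ← hfφ (Ioo_subset_Icc_self hz)] at this
  obtain ⟨hiff, heq⟩ := H.integrable_mixture_iff (hvm 1) (hvm 0) (hv0 1 h1I) (hv0 0 h0I)
  -- the bounded difference between a mixture and the corresponding variable of the statement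
  set U : (α → ℝ) → α → ℝ := fun Y z => Y z * f 1 + (1 - Y z) * f 0 - f (m (T z)) with hU
  have hUi : ∀ Y : α → ℝ, Measurable Y → (∀ z, Y z ∈ Icc (0 : ℝ) 1) → Integrable (U Y) π := by
    intro Y hY hYm
    refine Integrable.of_bound (Measurable.aestronglyMeasurable (by simp only [hU]; fun_prop))
      (3 * C) (ae_of_all _ fun z => ?_)
    have e1 := abs_le.1 (hfC 1 h1I)
    have e2 := abs_le.1 (hfC 0 h0I)
    have e3 := abs_le.1 (hfC _ (H.regression_mem (T z)))
    have e4 := hYm z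
    rw [Real.norm_eq_abs, abs_le]
    constructor <;> simp only [hU] <;> nlinarith [e4.1, e4.2]
  have hdec : ∀ Y : α → ℝ, (fun z => f (m (T z)) - f (T z) - deriv φ (T z) * (Y z - T z))
      = fun z => (v 1 (T z) * Y z + v 0 (T z) * (1 - Y z)) - U Y z := by
    intro Y
    ext z
    simp only [hv, hU]
    ring
  have hUA := hUi A hA H.response_mem
  have hUm := hUi (fun z => m (T z)) (hm.comp hT) fun z => H.regression_mem _
  have hiffY : ∀ {V U' : α → ℝ}, Integrable U' π →
      (Integrable (fun z => V z - U' z) π ↔ Integrable V π) := by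
    intro V U' hU'
    refine ⟨fun h => (h.add hU').congr (ae_of_all _ fun z => ?_), fun h => h.sub hU'⟩
    simp
  have hres : Integrable (fun z => f (m (T z)) - f (T z) - deriv φ (T z) * (A z - T z)) π
      ↔ Integrable (fun z => f (m (T z)) - f (T z) - deriv φ (T z) * (m (T z) - T z)) π := by
    rw [hdec A, hdec fun z => m (T z), hiffY hUA, hiffY hUm]
    exact hiff
  refine ⟨hres, ?_⟩
  by_cases hi : Integrable (fun z => f (m (T z)) - f (T z) - deriv φ (T z) * (A z - T z)) π
  swap
  · rw [integral_undef hi, integral_undef fun h => hi (hres.2 h)]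
  have hi2 := hres.1 hi
  have hdA := hdec A
  have hdm := hdec fun z => m (T z)
  rw [hdA] at hi ⊢
  rw [hdm] at hi2 ⊢
  have hUeq : ∫ z, U A z ∂π = ∫ z, U (fun z => m (T z)) z ∂π := by
    have hAm : ∫ z, A z ∂π = ∫ z, m (T z) ∂π := by
      simpa using H.integral_mul_eq (f := fun _ => 1) measurable_const (C := 1) (by simp)
    have hmi : Integrable (fun z => m (T z)) π :=
      Integrable.of_bound (hm.comp hT).aestronglyMeasurable 1 (ae_of_all _ fun z => by
        rw [Real.norm_eq_abs, abs_of_nonneg (H.regression_mem _).1]; exact (H.regression_mem _).2)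
    have hfi : Integrable (fun z => f (m (T z))) π :=
      Integrable.of_bound (hfm.comp (hm.comp hT)).aestronglyMeasurable C
        (ae_of_all _ fun z => hfC _ (H.regression_mem _))
    have hlin : ∀ Y : α → ℝ, Integrable Y π →
        ∫ z, U Y z ∂π = (f 1 - f 0) * ∫ z, Y z ∂π + f 0 - ∫ z, f (m (T z)) ∂π := by
      intro Y hY
      have : U Y = fun z => ((f 1 - f 0) * Y z + f 0) - f (m (T z)) := by
        ext z
        simp only [hU]
        ring
      have hadd : Integrable (fun z => (f 1 - f 0) * Y z + f 0) π :=
        (hY.const_mul _).add (integrable_const _)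
      rw [this, integral_sub hadd hfi,
        integral_add (hY.const_mul _) (integrable_const _), integral_const_mul]
      simp
    rw [hlin A H.integrable_response, hlin _ hmi, hAm]
  rw [integral_sub ((hiffY hUA).1 hi) hUA, integral_sub ((hiffY hUm).1 hi2) hUm, heq, hUeq]

end Divergence

/-! ### The plug-in error along an i.i.d. sample -/

section Sample

variable {α : Type*} [MeasurableSpace α] {π : Measure α} [IsProbabilityMeasure π] {T A : α → ℝ}
  {m : ℝ → ℝ} {K : ℝ → ℝ}
  {Ω : Type*} [MeasurableSpace Ω] {P : Measure Ω} {Z : ℕ → Ω → α}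

theorem tendsto_measure_le_pluginError (hK : IsRegularKernel K) (H : IsRegressionModel π T A m)
    (hball : ∀ᵐ w ∂π, ∃ c > 0, ∀ᶠ r in 𝓝[>] (0 : ℝ),
      c * r ≤ π.real (T ⁻¹' Metric.closedBall (T w) r))
    {S : Set ℝ} (hS : ∀ᵐ z ∂π, T z ∈ S) (hm : ContinuousOn m S)
    {s : ℕ → ℝ} (hs0 : ∀ n, 0 < s n) (hs : Tendsto s atTop (𝓝 0))
    (hns : Tendsto (fun n : ℕ => n * s n) atTop atTop)
    {f : ℝ → ℝ} (hf : Continuous f) {C : ℝ} (hC : ∀ x ∈ Icc (0 : ℝ) 1, |f x| ≤ C)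
    (hZ : ∀ i, Measurable (Z i)) (hZ_indep : iIndepFun Z P) (hZ_law : ∀ i, P.map (Z i) = π)
    {ε : ℝ} (hε : 0 < ε) :
    Tendsto (fun n : ℕ => P {ω | ε ≤ (1 / (n : ℝ)) * ∑ i : Fin n,
      |f (nadarayaWatson K (s n) (fun j : Fin n => T (Z j ω)) (fun j => A (Z j ω)) (T (Z i ω)))
        - f (m (T (Z i ω)))|}) atTop (𝓝 0) := by
  have hlim := tendsto_lintegral_pluginError hK H hball hS hm hs0 hs hns hf hC
  have hlim2 := ENNReal.Tendsto.div_const hlim (b := ENNReal.ofReal ε)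
    (Or.inr (by simpa using hε))
  rw [ENNReal.zero_div] at hlim2
  refine tendsto_of_tendsto_of_tendsto_of_le_of_le tendsto_const_nhds hlim2 (fun _ => zero_le)
    fun n => ?_
  have hT := H.measurable_covariate
  have hA := H.measurable_response
  have hKm := hK.measurable
  have hmm := H.measurable_regression
  have hfm := hf.measurable
  set E : (Fin n → α) → ℝ≥0∞ := fun z => ENNReal.ofReal ((1 / (n : ℝ)) * ∑ i,
      |f (nadarayaWatson K (s n) (fun j => T (z j)) (fun j => A (z j)) (T (z i)))
        - f (m (T (z i)))|) with hE
  have hEm : Measurable E := by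
    have hk : ∀ i j : Fin n, Measurable fun z : Fin n → α =>
        scaledKernel K (s n) (T (z i) - T (z j)) := fun i j => by
      unfold scaledKernel
      fun_prop
    have hnw : ∀ i : Fin n, Measurable fun z : Fin n → α =>
        nadarayaWatson K (s n) (fun j => T (z j)) (fun j => A (z j)) (T (z i)) := fun i => by
      refine Measurable.div (Finset.measurable_sum _ fun j _ => (hk i j).mul ?_)
        (Finset.measurable_sum _ fun j _ => hk i j)
      fun_prop
    refine ((Finset.measurable_sum _ fun i _ => ?_).const_mul _).ennreal_ofReal
    refine measurable_abs.comp ((hfm.comp (hnw i)).sub ?_)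
    fun_prop
  have hlaw : P.map (fun ω (i : Fin n) => Z i ω) = Measure.pi fun _ => π := by
    have hind : iIndepFun (fun i : Fin n => Z i) P := hZ_indep.precomp Fin.val_injective
    have h1 := iIndepFun.map_fun_eq_pi_map (f := fun i : Fin n => Z i)
      (fun i => (hZ i).aemeasurable) hind
    simp only [hZ_law] at h1
    exact h1
  have hZm : Measurable fun ω (i : Fin n) => Z i ω := measurable_pi_lambda _ fun i => hZ i
  rw [← hlaw, lintegral_map hEm hZm]
  refine le_trans (measure_mono fun ω hω => ?_)
    (meas_ge_le_lintegral_div (hEm.comp hZm).aemeasurable (by simpa using hε)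
      ENNReal.ofReal_ne_top)
  exact ENNReal.ofReal_le_ofReal hω

end Sample

/-! ### Consistency of the plug-in estimate -/

theorem tendsto_nat_mul_of_tendsto_mul_sq_div_log {s : ℕ → ℝ} (hs0 : ∀ n, 0 < s n)
    (hs : Tendsto s atTop (𝓝 0))
    (hrate : Tendsto (fun n : ℕ => (n : ℝ) * s n ^ 2 / Real.log n) atTop atTop) :
    Tendsto (fun n : ℕ => n * s n) atTop atTop := by
  refine tendsto_atTop_mono' _ ?_ hrate
  have hlog : Tendsto (fun n : ℕ => Real.log n) atTop atTop :=
    Real.tendsto_log_atTop.comp tendsto_natCast_atTop_atTop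
  filter_upwards [hs.eventually (gt_mem_nhds one_pos), hlog.eventually_ge_atTop 1] with n h1 h2
  have h3 : (n : ℝ) * s n ^ 2 ≤ n * s n := by
    refine mul_le_mul_of_nonneg_left ?_ n.cast_nonneg
    nlinarith [hs0 n]
  exact (div_le_self (mul_nonneg n.cast_nonneg (sq_nonneg _)) h2).trans h3

/-- A version of `E[A | T]` that is continuous on the support of the law of `T` can be truncated to
`[0, 1]` there and set to zero elsewhere, which makes it a regression function. -/
theorem exists_isRegressionModel {α : Type*} [MeasurableSpace α] {π : Measure α}
    [IsProbabilityMeasure π] {T A : α → ℝ} (hT : Measurable T) (hA : Measurable A)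
    (hA01 : ∀ z, A z ∈ Icc (0 : ℝ) 1) {m : ℝ → ℝ} (hm : ContinuousOn m (π.map T).support)
    (hcond : π[A | MeasurableSpace.comap T inferInstance] =ᵐ[π] fun z => m (T z)) :
    ∃ m' : ℝ → ℝ, IsRegressionModel π T A m' ∧ ContinuousOn m' (π.map T).support ∧
      ∀ᵐ z ∂π, T z ∈ (π.map T).support := by
  classical
  have hsupp : ∀ᵐ z ∂π, T z ∈ (π.map T).support :=
    ae_of_ae_map hT.aemeasurable (p := fun t => t ∈ (π.map T).support) Measure.support_mem_ae
  have hSm : MeasurableSet (π.map T).support := Measure.isClosed_support.measurableSet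
  set p : ℝ → ℝ := fun t => max 0 (min 1 (m t)) with hp
  have hpc : ContinuousOn p (π.map T).support :=
    continuousOn_const.sup (continuousOn_const.inf hm)
  set m' : ℝ → ℝ := (π.map T).support.piecewise p fun _ => 0 with hm'
  have hAi : Integrable A π := Integrable.of_bound hA.aestronglyMeasurable 1
    (ae_of_all _ fun z => by
      rw [Real.norm_eq_abs, abs_of_nonneg (hA01 z).1]; exact (hA01 z).2)
  have hle : MeasurableSpace.comap T inferInstance ≤ _ := hT.comap_le
  refine ⟨m', ⟨hT, hA, hA01, hpc.measurable_piecewise continuousOn_const hSm, fun t => ?_, ?_⟩,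
    hpc.congr fun t ht => piecewise_eq_of_mem _ _ _ ht, hsupp⟩
  · by_cases ht : t ∈ (π.map T).support
    · rw [hm', piecewise_eq_of_mem _ _ _ ht]
      exact ⟨le_max_left _ _, max_le zero_le_one (min_le_left _ _)⟩
    · rw [hm', piecewise_eq_of_notMem _ _ _ ht]
      simp
  · have h0 : 0 ≤ᵐ[π] π[A | MeasurableSpace.comap T inferInstance] :=
      condExp_nonneg (ae_of_all _ fun z => (hA01 z).1)
    have h1 : π[A | MeasurableSpace.comap T inferInstance]
        ≤ᵐ[π] π[fun _ => (1 : ℝ) | MeasurableSpace.comap T inferInstance] :=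
      condExp_mono hAi (integrable_const _) (ae_of_all _ fun z => (hA01 z).2)
    rw [condExp_const hle] at h1
    filter_upwards [h0, h1, hcond, hsupp] with z h0 h1 hz hzS
    rw [Pi.zero_apply] at h0
    rw [hm', piecewise_eq_of_mem _ _ _ hzS, hp]
    simp only
    rw [← hz, min_eq_right h1, max_eq_right h0]

theorem mainTheorem2 {d k : ℕ}
    (π : Measure (EuclideanSpace ℝ (Fin d) × Fin k)) [IsProbabilityMeasure π]
    (g : EuclideanSpace ℝ (Fin d) → stdSimplex ℝ (Fin k)) (hg : Measurable g)
    (c : stdSimplex ℝ (Fin k) → Fin k) (hc : Measurable c)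
    (h : stdSimplex ℝ (Fin k) → Icc (0 : ℝ) 1) (hh : Measurable h)
    (φ : ℝ → ℝ) (hφ : IsBregmanGenerator φ)
    (K : ℝ → ℝ) (hK : IsRegularKernel K)
    (σ : ℕ → ℝ) (hσ_pos : ∀ n, 0 < σ n) (hσ_zero : Tendsto σ atTop (𝓝 0))
    (hσ_rate : Tendsto (fun n : ℕ => (n : ℝ) * σ n ^ 2 / Real.log n) atTop atTop)
    -- `h(X)` has a density, bounded away from zero where `h(X)` lives
    (hpdf : HasPDF (confidence g h) π volume)
    (hpdf_lower : ∃ δ : ℝ≥0∞, 0 < δ ∧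
      ∀ᵐ t ∂(π.map (confidence g h)), δ ≤ pdf (confidence g h) π volume t)
    -- a version of `E[1_{Y = c(X)} | h(X) = t]` is continuous in `t` on the support of `h(X)`
    (hcont : ∃ m : ℝ → ℝ, ContinuousOn m (π.map (confidence g h)).support ∧
      condAccuracy π g c h =ᵐ[π] fun z => m (confidence g h z))
    -- an i.i.d. sample from `π`
    {Ω : Type*} [MeasurableSpace Ω] (P : Measure Ω) [IsProbabilityMeasure P]
    (Z : ℕ → Ω → EuclideanSpace ℝ (Fin d) × Fin k) (hZ : ∀ i, Measurable (Z i))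
    (hZ_indep : iIndepFun Z P) (hZ_law : ∀ i, P.map (Z i) = π) :
    -- the calibration error is the expectation of a nonnegative variable, finite if `φ` is `C¹` on
    -- the closed interval
    (∀ᵐ z ∂π, 0 ≤ calibrationDivergence π g c h φ z) ∧
    AEStronglyMeasurable (calibrationDivergence π g c h φ) π ∧
    (ContDiffOn ℝ 1 φ (Icc 0 1) → Integrable (calibrationDivergence π g c h φ) π) ∧
    -- finite calibration error: convergence in probability to it
    (Integrable (calibrationDivergence π g c h φ) π →
      TendstoInMeasure P
        (fun (n : ℕ) ω => pluginEstimate K (σ n) g c h φ (fun i : Fin n => Z i ω)) atTop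
        (fun _ => ∫ z, calibrationDivergence π g c h φ z ∂π)) ∧
    -- infinite calibration error: convergence in probability to `∞`
    (¬ Integrable (calibrationDivergence π g c h φ) π →
      ∀ M : ℝ, Tendsto (fun n : ℕ =>
        P {ω | pluginEstimate K (σ n) g c h φ (fun i : Fin n => Z i ω) ≤ M}) atTop (𝓝 0)) := by
  set T := confidence g h with hTdef
  set A := accuracy g c with hAdef
  have hT : Measurable T :=
    measurable_subtype_coe.comp (hh.comp (hg.comp measurable_fst))
  have hA : Measurable A :=
    Measurable.ite (measurableSet_eq_fun measurable_snd (hc.comp (hg.comp measurable_fst)))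
      measurable_const measurable_const
  have hT01 : ∀ z, T z ∈ Icc (0 : ℝ) 1 := fun z => (h (g z.1)).2
  have hA01 : ∀ z, A z ∈ Icc (0 : ℝ) 1 := fun z => by
    simp only [hAdef, accuracy]
    split_ifs <;> simp
  have hac : π.map T ≪ volume := hpdf.absolutelyContinuous
  obtain ⟨m₀, hm₀, hcond⟩ := hcont
  obtain ⟨m, H, hm, hS⟩ := exists_isRegressionModel hT hA hA01 hm₀ hcond
  -- the endpoints, where the derivative of `φ` may be infinite, carry no mass
  have hIoo : ∀ᵐ z ∂π, T z ∈ Ioo (0 : ℝ) 1 := by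
    have hne : ∀ x : ℝ, ∀ᵐ z ∂π, T z ≠ x := fun x =>
      ae_of_ae_map hT.aemeasurable (p := fun t => t ≠ x)
        (hac.ae_le (measure_mono_null (by simp) (Real.volume_singleton (a := x))))
    filter_upwards [hne 0, hne 1] with z h0 h1
    exact ⟨lt_of_le_of_ne (hT01 z).1 (Ne.symm h0), lt_of_le_of_ne (hT01 z).2 h1⟩
  obtain ⟨f, hf, hfφ⟩ := hφ.exists_continuous_eqOn
  obtain ⟨C, hC0, hC⟩ := hφ.exists_abs_le
  have hfC : ∀ x ∈ Icc (0 : ℝ) 1, |f x| ≤ C := fun x hx => by rw [hfφ hx]; exact hC x hx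
  have hfm := hf.measurable
  have hmm := H.measurable_regression
  have hd : Measurable (deriv φ) := measurable_deriv φ
  set D : EuclideanSpace ℝ (Fin d) × Fin k → ℝ :=
    fun z => f (m (T z)) - f (T z) - deriv φ (T z) * (m (T z) - T z) with hD
  set W : EuclideanSpace ℝ (Fin d) × Fin k → ℝ :=
    fun z => f (m (T z)) - f (T z) - deriv φ (T z) * (A z - T z) with hW
  have hDm : Measurable D := by fun_prop
  have hWm : Measurable W := by fun_prop
  have hcal : calibrationDivergence π g c h φ =ᵐ[π] fun z => bregman φ (m (T z)) (T z) := by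
    filter_upwards [H.condExp_eq] with z hz
    unfold calibrationDivergence condAccuracy
    rw [hz]
  have hcalD : calibrationDivergence π g c h φ =ᵐ[π] D := by
    filter_upwards [hcal, hIoo] with z hz hzI
    rw [hz, bregman, IsBregmanGenerator.derivUnit_eq_deriv hzI, ← hfφ (H.regression_mem _),
      ← hfφ (Ioo_subset_Icc_self hzI)]
  have hmeas : AEStronglyMeasurable (calibrationDivergence π g c h φ) π :=
    hDm.aestronglyMeasurable.congr hcalD.symm
  obtain ⟨hWD, hWDint⟩ := hφ.integrable_summand_iff hf hfφ H hIoo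
  have hball := ae_exists_mul_le_measureReal_closedBall hT hac
  have hns := tendsto_nat_mul_of_tendsto_mul_sq_div_log hσ_pos hσ_zero hσ_rate
  have herr : ∀ ε : ℝ, 0 < ε → _ := fun ε hε => tendsto_measure_le_pluginError hK H hball hS hm
    hσ_pos hσ_zero hns hf hfC hZ hZ_indep hZ_law hε
  set E : (n : ℕ) → Ω → ℝ := fun n ω => (1 / (n : ℝ)) * ∑ i : Fin n,
      |f (nadarayaWatson K (σ n) (fun j : Fin n => T (Z j ω)) (fun j => A (Z j ω)) (T (Z i ω)))
        - f (m (T (Z i ω)))| with hE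
  -- up to the plug-in error, the estimate is an average of independent copies of `W`
  have hclose : ∀ᵐ ω ∂P, ∀ n : ℕ, |pluginEstimate K (σ n) g c h φ (fun i : Fin n => Z i ω)
      - (1 / (n : ℝ)) * ∑ i : Fin n, W (Z i ω)| ≤ E n ω := by
    have hZIoo : ∀ᵐ ω ∂P, ∀ i, T (Z i ω) ∈ Ioo (0 : ℝ) 1 := ae_all_iff.2 fun i =>
      ae_of_ae_map (hZ i).aemeasurable (p := fun z => T z ∈ Ioo (0 : ℝ) 1)
        (by rw [hZ_law i]; exact hIoo)
    filter_upwards [hZIoo] with ω hω n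
    rw [pluginEstimate, ← mul_sub, ← Finset.sum_sub_distrib, abs_mul,
      abs_of_nonneg (show (0 : ℝ) ≤ 1 / (n : ℝ) by positivity)]
    refine mul_le_mul_of_nonneg_left ((Finset.abs_sum_le_sum_abs _ _).trans
      (Finset.sum_le_sum fun i _ => le_of_eq ?_)) (by positivity)
    obtain ⟨n, rfl⟩ : ∃ n', n = n' + 1 := ⟨n - 1, by have := i.pos; omega⟩
    have hnw := nadarayaWatson_eq_centeredRegression K (hσ_pos (n + 1)) T A
      (fun i : Fin (n + 1) => Z i ω) i
    have hnwI := centeredRegression_mem hK H (σ (n + 1)) (Z i ω)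
      (i.removeNth fun i : Fin (n + 1) => Z i ω)
    rw [← hnw] at hnwI
    congr 1
    simp only [hW]
    rw [← hTdef, ← hAdef, IsBregmanGenerator.derivUnit_eq_deriv (hω i), hfφ hnwI,
      hfφ (Ioo_subset_Icc_self (hω i))]
    ring
  refine ⟨?_, hmeas, fun hC1 => ?_, fun hint => ?_, fun hint M => ?_⟩
  · filter_upwards [hcal, hIoo] with z hz hzI
    rw [hz]
    exact hφ.bregman_nonneg (H.regression_mem _) hzI
  · obtain ⟨B, hB⟩ := isCompact_Icc.exists_bound_of_continuousOn
      (hC1.continuousOn_derivWithin (uniqueDiffOn_Icc zero_lt_one) le_rfl)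
    refine Integrable.of_bound hmeas (2 * C + B) ?_
    filter_upwards [hcal] with z hz
    have h1 := hC _ (H.regression_mem (T z))
    have h2 := hC _ (hT01 z)
    have h3 : |derivUnit φ (T z)| ≤ B := hB _ (hT01 z)
    have h4 : |m (T z) - T z| ≤ 1 := by
      have e1 := H.regression_mem (T z)
      have e2 := hT01 z
      rw [abs_le]
      constructor <;> linarith [e1.1, e1.2, e2.1, e2.2]
    have h5 : |derivUnit φ (T z) * (m (T z) - T z)| ≤ B := by
      rw [abs_mul]
      nlinarith [abs_nonneg (derivUnit φ (T z)), abs_nonneg (m (T z) - T z)]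
    rw [hz, bregman, Real.norm_eq_abs]
    refine (abs_sub _ _).trans (add_le_add ((abs_sub _ _).trans ?_) h5)
    linarith
  · have hWi : Integrable W π := hWD.2 (hint.congr hcalD)
    have hI : ∫ z, calibrationDivergence π g c h φ z ∂π = ∫ z, W z ∂π := by
      rw [integral_congr_ae hcalD, hWDint]
    rw [hI, tendstoInMeasure_iff_dist]
    intro ε hε
    have hlln := tendstoInMeasure_iff_dist.1
      (tendstoInMeasure_average hZ hZ_indep hZ_law hWm hWi) (ε / 2) (half_pos hε)
    have hsum := hlln.add (herr (ε / 2) (half_pos hε))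
    rw [add_zero] at hsum
    refine tendsto_of_tendsto_of_tendsto_of_le_of_le tendsto_const_nhds hsum (fun _ => zero_le)
      fun n => (measure_mono_ae ?_).trans (measure_union_le _ _)
    filter_upwards [hclose] with ω hω hle
    have hω := hω n
    have hle : ε ≤ dist (pluginEstimate K (σ n) g c h φ (fun i : Fin n => Z i ω))
      (∫ z, W z ∂π) := hle
    by_contra hcon
    obtain ⟨h1, h2⟩ := not_or.1 hcon
    have h1 : ¬ ε / 2 ≤ dist ((1 / (n : ℝ)) * ∑ i : Fin n, W (Z i ω)) (∫ z, W z ∂π) := h1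
    have h2 : ¬ ε / 2 ≤ E n ω := h2
    have := dist_triangle (pluginEstimate K (σ n) g c h φ (fun i : Fin n => Z i ω))
      ((1 / (n : ℝ)) * ∑ i : Fin n, W (Z i ω)) (∫ z, W z ∂π)
    rw [← Real.dist_eq] at hω
    linarith
  · have hWi : ¬ Integrable W π := fun hWi => hint ((hWD.1 hWi).congr hcalD.symm)
    have hlln := tendsto_measure_average_le hZ hZ_indep hZ_law hWm (B := 2 * C) (by positivity)
      (hφ.ae_le_summand hfφ H hIoo hC) hWi (M + 1)
    have hsum := hlln.add (herr 1 one_pos)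
    rw [add_zero] at hsum
    refine tendsto_of_tendsto_of_tendsto_of_le_of_le tendsto_const_nhds hsum (fun _ => zero_le)
      fun n => (measure_mono_ae ?_).trans (measure_union_le _ _)
    filter_upwards [hclose] with ω hω hle
    have hω := (abs_le.1 (hω n)).1
    have hle : pluginEstimate K (σ n) g c h φ (fun i : Fin n => Z i ω) ≤ M := hle
    by_contra hcon
    obtain ⟨h1, h2⟩ := not_or.1 hcon
    have h1 : ¬ (1 / (n : ℝ)) * ∑ i : Fin n, W (Z i ω) ≤ M + 1 := h1
    have h2 : ¬ 1 ≤ E n ω := h2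
    linarith
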